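/- Let $\mathbb K\in\{\mathbb R,\mathbb C\}$. Locally convex spaces are over $\mathbb K$; neither they nor topological groups are assumed Hausdorff. A map $f\colon U\to F$ from an open subset $U$ of a Hausdorff locally convex space $E$ to a Hausdorff locally convex space $F$ is $C^\infty_{\mathbb K}$ if it is continuous and, for every $k\in\mathbb N$, the iterated directional derivatives $d^kf(x,y_1,\dots,y_k)=D_{y_1}\cdots D_{y_k}f(x)$ (over $\mathbb K$) exist for all $x\in U$, $y_1,\dots,y_k\in E$ and define a continuous map $d^kf\colon U\times E^k\to F$. A $C^\infty_{\mathbb K}$-manifold is a Hausdorff space with a maximal atlas of charts onto open subsets of a fixed Hausdorff locally convex space (its modelling space), with $C^\infty_{\mathbb K}$ transition maps; a $C^\infty_{\mathbb K}$-Lie group is a group which is a $C^\infty_{\mathbb K}$-manifold with $C^\infty_{\mathbb K}$ multiplication and inversion. (For $\mathbb K=\mathbb R$ these are the smooth Lie groups, for $\mathbb K=\mathbb C$ the complex analytic ones.) Let $G$ be a $C^\infty_{\mathbb K}$-Lie group with $G=\bigcup_{n\in\mathbb N}G_n$, where $G_1\subseteq G_2\subseteq\cdots$ is an ascending sequence of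 $C^\infty_{\mathbb K}$-Lie groups such that all inclusion maps $i_{n,m}\colon G_m\to G_n$ ($m\le n$) and $i_n\colon G_n\to G$ are $C^\infty_{\mathbb K}$-homomorphisms. Let $E$ and $E_n$ be the modelling spaces of $G$ and $G_n$. Suppose that $G$ admits a direct limit chart, that is, there are a chart $\phi\colon U\to V\subseteq E$ of $G$ with $1\in U$ and an $n_0\in\mathbb N$ such that: (a) there are continuous linear maps $j_{n,m}\colon E_m\to E_n$ for $n\ge m\ge n_0$ and $j_n\colon E_n\to E$ for $n\ge n_0$ such that $((E_n)_{n\ge n_0},(j_{n,m})_{n\ge m\ge n_0})$ is a direct system, $E=\bigcup_{n\ge n_0}j_n(E_n)$, and $(E,(j_n)_{n\ge n_0})$ is the direct limit of this system in the category of locally convex spaces and continuous linear maps; (b) there are charts $\phi_n\colon U_n\to V_n\subseteq E_n$ of $G_n$ for $n\ge n_0$ such that $U_m\subseteq U_n$ and $j_{n,m}(V_m)\subseteq V_n$ if $n\ge m\ge n_0$, $U=\bigcup_{n\ge n_0}U_n$, $V=\bigcup_{n\ge n_0}j_n(V_n)$, and $\phi\circ i_n|_{U_n}=j_n|_{V_n}\circ\phi_n$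 for each $n\ge n_0$. If $(G,(i_n)_{n\in\mathbb N})$ is the direct limit of $((G_n)_{n\in\mathbb N},(i_{n,m})_{n\ge m})$ in the category of topological groups and continuous homomorphisms, then it is also its direct limit in the category of $C^\infty_{\mathbb K}$-Lie groups and $C^\infty_{\mathbb K}$-homomorphisms. -/

import Mathlib

open Set Filter Topology

universe u v w

/-- A locally convex topological vector space over `𝕜 ∈ {ℝ, ℂ}`, not necessarily Hausdorff.
Convexity refers to the underlying real vector space. -/
structure IsLocallyConvexTVS (𝕜 : Type*) [RCLike 𝕜] (E : Type*) [AddCommGroup E] [Module 𝕜 E]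
    [TopologicalSpace E] : Prop where
  topologicalAddGroup : IsTopologicalAddGroup E
  continuousSMul : ContinuousSMul 𝕜 E
  locallyConvex :
    letI : Module ℝ E := Module.compHom E (algebraMap ℝ 𝕜)
    LocallyConvexSpace ℝ E

/-- `l` is the directional derivative `D_y f(x)` over `𝕜`, that is, the limit of
`(f (x + t y) - f x) / t` as `0 ≠ t → 0` in `𝕜`. -/
def HasDirectionalDeriv (𝕜 : Type*) [RCLike 𝕜] {E F : Type*} [AddCommGroup E] [Module 𝕜 E]
    [AddCommGroup F] [Module 𝕜 F] [TopologicalSpace F] (f : E → F) (l : F) (x y : E) : Prop :=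
  Tendsto (fun t : 𝕜 => t⁻¹ • (f (x + t • y) - f x)) (𝓝[≠] (0 : 𝕜)) (𝓝 l)

/-- `f` is of class `C^∞` over `𝕜`, in the sense of Keller's `C^∞_c`-theory, on the open set `U`:
`f` is continuous on `U`, all iterated directional derivatives
`d k x (y₁, …, yₖ) = D_{y₁} ⋯ D_{yₖ} f (x)` exist for `x ∈ U`, and they define continuous maps
`d k : U × E^k → F`. Only the values of `f` on `U` matter. -/
def IsCInftyOn (𝕜 : Type*) [RCLike 𝕜] {E F : Type*} [AddCommGroup E] [Module 𝕜 E]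
    [TopologicalSpace E] [AddCommGroup F] [Module 𝕜 F] [TopologicalSpace F]
    (f : E → F) (U : Set E) : Prop :=
  ∃ d : (k : ℕ) → E → (Fin k → E) → F,
    (∀ x ∈ U, ∀ ys, d 0 x ys = f x) ∧
    (∀ k, ∀ x ∈ U, ∀ (y : E) (ys : Fin k → E),
      HasDirectionalDeriv 𝕜 (fun z => d k z ys) (d (k + 1) x (Matrix.vecCons y ys)) x y) ∧
    (∀ k, ContinuousOn (fun p : E × (Fin k → E) => d k p.1 p.2) (U ×ˢ univ))

/-- The expression `e' ∘ f ∘ e⁻¹` of `f` in the charts `e` and `e'` is `C^∞` over `𝕜` where it is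
defined (for continuous `f`, this is an open set). -/
def IsCInftyInCharts (𝕜 : Type*) [RCLike 𝕜] {E F M N : Type*} [AddCommGroup E] [Module 𝕜 E]
    [TopologicalSpace E] [AddCommGroup F] [Module 𝕜 F] [TopologicalSpace F]
    [TopologicalSpace M] [TopologicalSpace N]
    (e : OpenPartialHomeomorph M E) (e' : OpenPartialHomeomorph N F) (f : M → N) : Prop :=
  IsCInftyOn 𝕜 (e' ∘ f ∘ e.symm) (e.target ∩ e.symm ⁻¹' (f ⁻¹' e'.source))

/-- A `C^∞`-manifold over `𝕜`, modelled on the Hausdorff locally convex space `E`: a Hausdorff space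
with an atlas of charts in `E` whose transition maps are `C^∞`. -/
structure IsCInftyManifold (𝕜 : Type*) [RCLike 𝕜] (E : Type*) [AddCommGroup E] [Module 𝕜 E]
    [TopologicalSpace E] (M : Type*) [TopologicalSpace M] [ChartedSpace E M] : Prop where
  model_locallyConvex : IsLocallyConvexTVS 𝕜 E
  model_t2 : T2Space E
  t2 : T2Space M
  transition : ∀ e ∈ atlas E M, ∀ e' ∈ atlas E M, IsCInftyInCharts 𝕜 e e' (id : M → M)

/-- `φ` is a chart of the `C^∞`-manifold `M`, i.e. an element of its maximal atlas. -/
def IsCInftyChart (𝕜 : Type*) [RCLike 𝕜] {E : Type*} [AddCommGroup E] [Module 𝕜 E]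
    [TopologicalSpace E] {M : Type*} [TopologicalSpace M] [ChartedSpace E M]
    (φ : OpenPartialHomeomorph M E) : Prop :=
  ∀ e ∈ atlas E M, IsCInftyInCharts 𝕜 e φ (id : M → M) ∧ IsCInftyInCharts 𝕜 φ e (id : M → M)

/-- `C^∞`-maps over `𝕜` between manifolds modelled on `E` and `F`. -/
def IsCInftyMap (𝕜 : Type*) [RCLike 𝕜] (E F : Type*) [AddCommGroup E] [Module 𝕜 E]
    [TopologicalSpace E] [AddCommGroup F] [Module 𝕜 F] [TopologicalSpace F]
    {M N : Type*} [TopologicalSpace M] [ChartedSpace E M] [TopologicalSpace N] [ChartedSpace F N]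
    (f : M → N) : Prop :=
  Continuous f ∧ ∀ e ∈ atlas E M, ∀ e' ∈ atlas F N, IsCInftyInCharts 𝕜 e e' f

/-- A `C^∞`-Lie group over `𝕜` modelled on `E`: a group and `C^∞`-manifold whose multiplication
`G × G → G` and inversion `G → G` are `C^∞`. The product manifold `G × G` carries the atlas of
products of charts. -/
structure IsCInftyLieGroup (𝕜 : Type*) [RCLike 𝕜] (E : Type*) [AddCommGroup E] [Module 𝕜 E]
    [TopologicalSpace E] (G : Type*) [Group G] [TopologicalSpace G] [ChartedSpace E G] : Prop where
  manifold : IsCInftyManifold 𝕜 E G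
  continuous_mul : Continuous (fun p : G × G => p.1 * p.2)
  mul_charts : ∀ e₁ ∈ atlas E G, ∀ e₂ ∈ atlas E G, ∀ e₃ ∈ atlas E G,
    IsCInftyInCharts 𝕜 (e₁.prod e₂) e₃ (fun p : G × G => p.1 * p.2)
  inv : IsCInftyMap 𝕜 E E (fun g : G => g⁻¹)

/-- `G = ⋃ₙ Gₙ` as a `C^∞`-Lie group: an ascending sequence of `C^∞`-Lie groups `Gₙ` with union `G`
whose inclusion maps `ι : Gₘ → Gₙ` (for `m ≤ n`) and `i n : Gₙ → G` are `C^∞`-homomorphisms.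
The `Gₙ` carry their own Lie group structures, so the inclusions are recorded as injective
homomorphisms. -/
structure IsAscendingUnion (𝕜 : Type*) [RCLike 𝕜]
    (E : Type*) [AddCommGroup E] [Module 𝕜 E] [TopologicalSpace E]
    {G : Type*} [Group G] [TopologicalSpace G] [ChartedSpace E G]
    (En : ℕ → Type*) [∀ n, AddCommGroup (En n)] [∀ n, Module 𝕜 (En n)]
    [∀ n, TopologicalSpace (En n)]
    {Gn : ℕ → Type*} [∀ n, Group (Gn n)] [∀ n, TopologicalSpace (Gn n)]
    [∀ n, ChartedSpace (En n) (Gn n)]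
    (ι : ∀ {m n : ℕ}, m ≤ n → (Gn m →* Gn n)) (i : ∀ n, Gn n →* G) : Prop where
  lieGroup : IsCInftyLieGroup 𝕜 E G
  lieGroup_seq : ∀ n, IsCInftyLieGroup 𝕜 (En n) (Gn n)
  injective : ∀ n, Function.Injective (i n)
  comp : ∀ {m n : ℕ} (h : m ≤ n) (g : Gn m), i n (ι h g) = i m g
  iUnion_range : ⋃ n, range (i n) = univ
  cInfty_bonding : ∀ {m n : ℕ} (h : m ≤ n), IsCInftyMap 𝕜 (En m) (En n) (ι h)
  cInfty_incl : ∀ n, IsCInftyMap 𝕜 (En n) E (i n)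

/-- `((Eₙ)_{n ≥ n₀}, jj)` is a direct system of locally convex spaces and continuous linear maps,
`(E, (j n)_{n ≥ n₀})` is a cone over it, and this cone is a direct limit cone in the category of
(not necessarily Hausdorff) locally convex spaces. The values of `jj m n` and `j n` outside the range
`n₀ ≤ m ≤ n` are irrelevant. -/
structure IsDirectLimitLCS (𝕜 : Type*) [RCLike 𝕜]
    {E : Type u} [AddCommGroup E] [Module 𝕜 E] [TopologicalSpace E]
    {En : ℕ → Type*} [∀ n, AddCommGroup (En n)] [∀ n, Module 𝕜 (En n)]
    [∀ n, TopologicalSpace (En n)]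
    (n₀ : ℕ) (jj : ∀ m n, En m →L[𝕜] En n) (j : ∀ n, En n →L[𝕜] E) : Prop where
  system_id : ∀ n, n₀ ≤ n → ∀ y, jj n n y = y
  system_comp : ∀ l m n, n₀ ≤ l → l ≤ m → m ≤ n → ∀ y, jj m n (jj l m y) = jj l n y
  cone : ∀ m n, n₀ ≤ m → m ≤ n → ∀ y, j n (jj m n y) = j m y
  desc : ∀ (F : Type u) [AddCommGroup F] [Module 𝕜 F] [TopologicalSpace F],
    IsLocallyConvexTVS 𝕜 F → ∀ f : ∀ n, En n →L[𝕜] F,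
    (∀ m n, n₀ ≤ m → m ≤ n → ∀ y, f n (jj m n y) = f m y) →
    ∃! θ : E →L[𝕜] F, ∀ n, n₀ ≤ n → ∀ y, θ (j n y) = f n y

/-- The chart `φ : U → V ⊆ E` of `G = ⋃ₙ Gₙ` is a direct limit chart: for some `n₀`, the model space
`E` is the union of the images `j n (Eₙ)` for a direct system of locally convex spaces
`(Eₙ)_{n ≥ n₀}` with direct limit `E`, and there are charts `φs n : Uₙ → Vₙ ⊆ Eₙ` of `Gₙ` for
`n ≥ n₀`, compatible with the inclusions, such that `U = ⋃ₙ Uₙ`, `V = ⋃ₙ j n (Vₙ)` and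
`φ ∘ i n = j n ∘ φs n` on `Uₙ`. -/
def IsDirectLimitChart (𝕜 : Type*) [RCLike 𝕜]
    {E : Type u} [AddCommGroup E] [Module 𝕜 E] [TopologicalSpace E]
    {G : Type*} [Group G] [TopologicalSpace G] [ChartedSpace E G]
    (En : ℕ → Type*) [∀ n, AddCommGroup (En n)] [∀ n, Module 𝕜 (En n)]
    [∀ n, TopologicalSpace (En n)]
    {Gn : ℕ → Type*} [∀ n, Group (Gn n)] [∀ n, TopologicalSpace (Gn n)]
    [∀ n, ChartedSpace (En n) (Gn n)]
    (ι : ∀ {m n : ℕ}, m ≤ n → (Gn m →* Gn n)) (i : ∀ n, Gn n →* G)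
    (φ : OpenPartialHomeomorph G E) : Prop :=
  IsCInftyChart 𝕜 φ ∧
  ∃ (n₀ : ℕ) (jj : ∀ m n, En m →L[𝕜] En n) (j : ∀ n, En n →L[𝕜] E)
    (φs : ∀ n, OpenPartialHomeomorph (Gn n) (En n)),
    IsDirectLimitLCS 𝕜 n₀ jj j ∧
    (⋃ n ≥ n₀, range (j n)) = univ ∧
    (∀ n ≥ n₀, IsCInftyChart 𝕜 (φs n)) ∧
    (∀ (m n : ℕ) (h : m ≤ n), n₀ ≤ m → ι h '' (φs m).source ⊆ (φs n).source) ∧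
    (∀ (m n : ℕ), m ≤ n → n₀ ≤ m → jj m n '' (φs m).target ⊆ (φs n).target) ∧
    φ.source = ⋃ n ≥ n₀, i n '' (φs n).source ∧
    φ.target = ⋃ n ≥ n₀, j n '' (φs n).target ∧
    (∀ n ≥ n₀, ∀ g ∈ (φs n).source, φ (i n g) = j n (φs n g))

/-- The Lie group `G = ⋃ₙ Gₙ` admits a direct limit chart, i.e. it has one around `1`. -/
def AdmitsDirectLimitChart (𝕜 : Type*) [RCLike 𝕜]
    (E : Type u) [AddCommGroup E] [Module 𝕜 E] [TopologicalSpace E]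
    {G : Type*} [Group G] [TopologicalSpace G] [ChartedSpace E G]
    (En : ℕ → Type*) [∀ n, AddCommGroup (En n)] [∀ n, Module 𝕜 (En n)]
    [∀ n, TopologicalSpace (En n)]
    {Gn : ℕ → Type*} [∀ n, Group (Gn n)] [∀ n, TopologicalSpace (Gn n)]
    [∀ n, ChartedSpace (En n) (Gn n)]
    (ι : ∀ {m n : ℕ}, m ≤ n → (Gn m →* Gn n)) (i : ∀ n, Gn n →* G) : Prop :=
  ∃ φ : OpenPartialHomeomorph G E, (1 : G) ∈ φ.source ∧ IsDirectLimitChart 𝕜 En ι i φ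

/-- `(G, (i n)) = lim Gₙ` in the category of (not necessarily Hausdorff) topological groups and
continuous homomorphisms. -/
structure IsDirectLimitTopGroup {G : Type u} [Group G] [TopologicalSpace G]
    {Gn : ℕ → Type*} [∀ n, Group (Gn n)] [∀ n, TopologicalSpace (Gn n)]
    (ι : ∀ {m n : ℕ}, m ≤ n → (Gn m →* Gn n)) (i : ∀ n, Gn n →* G) : Prop where
  cone_mor : ∀ n, Continuous (i n)
  cone : ∀ {m n : ℕ} (h : m ≤ n) (g : Gn m), i n (ι h g) = i m g
  desc : ∀ (H : Type u) [Group H] [TopologicalSpace H] [IsTopologicalGroup H]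
    (f : ∀ n, Gn n →* H), (∀ n, Continuous (f n)) →
    (∀ {m n : ℕ} (h : m ≤ n) (g : Gn m), f n (ι h g) = f m g) →
    ∃! F : G →* H, Continuous F ∧ ∀ n g, F (i n g) = f n g

/-- `(G, (i n)) = lim Gₙ` in the category of `C^∞`-Lie groups over `𝕜` (modelled on arbitrary
Hausdorff locally convex spaces) and `C^∞`-homomorphisms; test objects `H` are taken in the universe
`v`, with model spaces `F` in the universe `w`. -/
structure IsDirectLimitLieGroup (𝕜 : Type*) [RCLike 𝕜]
    (E : Type*) [AddCommGroup E] [Module 𝕜 E] [TopologicalSpace E]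
    {G : Type*} [Group G] [TopologicalSpace G] [ChartedSpace E G]
    (En : ℕ → Type*) [∀ n, AddCommGroup (En n)] [∀ n, Module 𝕜 (En n)]
    [∀ n, TopologicalSpace (En n)]
    {Gn : ℕ → Type*} [∀ n, Group (Gn n)] [∀ n, TopologicalSpace (Gn n)]
    [∀ n, ChartedSpace (En n) (Gn n)]
    (ι : ∀ {m n : ℕ}, m ≤ n → (Gn m →* Gn n)) (i : ∀ n, Gn n →* G) : Prop where
  cone_mor : ∀ n, IsCInftyMap 𝕜 (En n) E (i n)
  cone : ∀ {m n : ℕ} (h : m ≤ n) (g : Gn m), i n (ι h g) = i m g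
  desc : ∀ (F : Type w) [AddCommGroup F] [Module 𝕜 F] [TopologicalSpace F]
    (H : Type v) [Group H] [TopologicalSpace H] [ChartedSpace F H],
    IsCInftyLieGroup 𝕜 F H → ∀ f : ∀ n, Gn n →* H,
    (∀ n, IsCInftyMap 𝕜 (En n) F (f n)) →
    (∀ {m n : ℕ} (h : m ≤ n) (g : Gn m), f n (ι h g) = f m g) →
    ∃! f' : G →* H, IsCInftyMap 𝕜 E F f' ∧ ∀ n g, f' (i n g) = f n g

/-! The homomorphism out of `G` is forced on each `Gₙ`, and it exists as an abstract homomorphism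
because `G` is a union of injected groups. It is continuous because `G` is the direct limit of
topological groups. What remains is smoothness: a continuous homomorphism `f : G → H` that is smooth
on every `Gₙ` is smooth (`AdmitsDirectLimitChart.isCInftyMap`).

In the direct limit chart, every point and every direction come from a common level `n`, so all
directional derivatives of `f` exist. At `1` they form a linear map `L : E → F`: linearity can be
tested at one level. `L` is continuous because it is so on each `Eₙ` and `E` is the locally convex
direct limit.

Joint continuity of the differential at other points would not follow from the levels, since the
open sets there are not known to generate a suitable topology on `U × E`. The group structure
replaces it. From `f x = f p * f (p⁻¹ * x)` one gets that `df (x, y)` is the derivative of the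
multiplication of `H` at `(f x, 1)` in the direction `(0, L (κ (x, y)))`, where `κ` is the left
trivialisation of the tangent bundle of `G`. Here `κ` and the multiplication are smooth, `L` is
continuous linear and `f` is continuous, so `df` is continuous; and if `f` is `C^k`, so is `df`,
hence `f` is `C^(k+1)` (`isCkOn_of_trivialized_differential`). Translations carry smoothness from
`1` to all of `G`.

The calculus needed is the chain rule for Keller's `C^∞_c`-maps, obtained from the mean value
theorem, and the equivalence of iterated directional derivatives with the recursive notion `IsCkOn`.
-/

/-! ### Mean value theorem and convex neighbourhoods -/

/-- Mean value theorem: if the derivative of a curve stays in a closed convex set, so does its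
increment over the unit interval. -/
theorem sub_mem_of_deriv_mem {F : Type*} [AddCommGroup F] [Module ℝ F] [TopologicalSpace F]
    [IsTopologicalAddGroup F] [ContinuousSMul ℝ F] [LocallyConvexSpace ℝ F]
    {γ γ' : ℝ → F} {C : Set F} (hC : Convex ℝ C) (hC' : IsClosed C)
    (h : ∀ s ∈ Icc (0 : ℝ) 1,
      Tendsto (fun r : ℝ => r⁻¹ • (γ (s + r) - γ s)) (𝓝[≠] 0) (𝓝 (γ' s)))
    (hmem : ∀ s ∈ Icc (0 : ℝ) 1, γ' s ∈ C) : γ 1 - γ 0 ∈ C := by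
  by_contra hn
  -- Separate the increment from `C` by a real functional; the scalar mean value theorem then gives
  -- a contradiction.
  obtain ⟨l, c, hl, hlt⟩ := geometric_hahn_banach_closed_point hC hC' hn
  have hd : ∀ s ∈ Icc (0 : ℝ) 1, HasDerivAt (fun s => l (γ s)) (l (γ' s)) s := by
    intro s hs
    rw [hasDerivAt_iff_tendsto_slope_zero]
    refine ((l.continuous.tendsto _).comp (h s hs)).congr fun r => ?_
    simp
  obtain ⟨s, hs, hs'⟩ := exists_hasDerivAt_eq_slope (fun s => l (γ s)) (fun s => l (γ' s))
    zero_lt_one (fun s hs => (hd s hs).continuousAt.continuousWithinAt)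
    (fun s hs => hd s (Ioo_subset_Icc_self hs))
  have h1 := hl _ (hmem s (Ioo_subset_Icc_self hs))
  rw [map_sub] at hlt
  simp only [sub_zero, div_one] at hs'
  linarith

/-- Every neighbourhood in a locally convex space contains a closed convex one. -/
theorem exists_closed_convex_nhds {F : Type*} [AddCommGroup F] [Module ℝ F] [TopologicalSpace F]
    [IsTopologicalAddGroup F] [ContinuousSMul ℝ F] [LocallyConvexSpace ℝ F] {a : F} {W : Set F}
    (hW : W ∈ 𝓝 a) : ∃ C ∈ 𝓝 a, C ⊆ W ∧ IsClosed C ∧ Convex ℝ C := by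
  obtain ⟨K, hK, hKc, hKW⟩ := exists_mem_nhds_isClosed_subset hW
  obtain ⟨S, ⟨hS, hSc⟩, hSK⟩ := (LocallyConvexSpace.convex_basis (𝕜 := ℝ) a).mem_iff.1 hK
  exact ⟨closure S, mem_of_superset hS subset_closure,
    (closure_minimal hSK hKc).trans hKW, isClosed_closure, hSc.closure⟩

/-! ### Directional derivatives, `C^k`-maps and the chain rule -/

section Calculus

variable {𝕜 : Type*} [RCLike 𝕜]

theorem tendsto_add_smul_nhds {E : Type*} [AddCommGroup E] [Module 𝕜 E] [TopologicalSpace E]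
    [IsTopologicalAddGroup E] [ContinuousSMul 𝕜 E] (x y : E) :
    Tendsto (fun t : 𝕜 => x + t • y) (𝓝[≠] 0) (𝓝 x) := by
  have : Continuous fun t : 𝕜 => x + t • y := by fun_prop
  simpa using (this.tendsto 0).mono_left nhdsWithin_le_nhds

theorem HasDirectionalDeriv.congr {E F : Type*} [AddCommGroup E] [Module 𝕜 E]
    [TopologicalSpace E] [IsTopologicalAddGroup E] [ContinuousSMul 𝕜 E]
    [AddCommGroup F] [Module 𝕜 F] [TopologicalSpace F] {f g : E → F} {l : F} {x y : E}
    (h : HasDirectionalDeriv 𝕜 f l x y) (hfg : g =ᶠ[𝓝 x] f) : HasDirectionalDeriv 𝕜 g l x y := by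
  refine Tendsto.congr' ?_ h
  filter_upwards [(tendsto_add_smul_nhds x y).eventually hfg] with t ht
  rw [ht, hfg.eq_of_nhds]

theorem HasDirectionalDeriv.smul_direction {E F : Type*} [AddCommGroup E] [Module 𝕜 E]
    [AddCommGroup F] [Module 𝕜 F] [TopologicalSpace F] [ContinuousSMul 𝕜 F]
    {f : E → F} {l : F} {x y : E}
    (h : HasDirectionalDeriv 𝕜 f l x y) (c : 𝕜) :
    HasDirectionalDeriv 𝕜 f (c • l) x (c • y) := by
  rcases eq_or_ne c 0 with rfl | hc
  · simpa [HasDirectionalDeriv] using tendsto_const_nhds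
  · have ht : Tendsto (fun t : 𝕜 => t * c) (𝓝[≠] 0) (𝓝[≠] 0) := by
      refine tendsto_nhdsWithin_iff.2 ⟨?_, ?_⟩
      · have : Continuous fun t : 𝕜 => t * c := by fun_prop
        simpa using (this.tendsto 0).mono_left nhdsWithin_le_nhds
      · filter_upwards [self_mem_nhdsWithin] with t ht
        exact mul_ne_zero ht hc
    refine ((h.comp ht).const_smul c).congr fun t => ?_
    simp only [Function.comp_apply, smul_smul, mul_inv]
    rw [mul_comm t⁻¹, ← mul_assoc, mul_inv_cancel₀ hc, one_mul]

/-- The difference quotients of a `C¹`-map converge locally uniformly to the differential. -/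
theorem tendsto_difference_quotient {E F : Type*} [AddCommGroup E] [Module 𝕜 E]
    [TopologicalSpace E] [IsTopologicalAddGroup E] [ContinuousSMul 𝕜 E]
    [AddCommGroup F] [Module 𝕜 F] [TopologicalSpace F] (hF : IsLocallyConvexTVS 𝕜 F)
    {f : E → F} {df : E × E → F} {U : Set E} (hU : IsOpen U)
    (hd : ∀ x ∈ U, ∀ y, HasDirectionalDeriv 𝕜 f (df (x, y)) x y)
    (hc : ContinuousOn df (U ×ˢ univ)) {x₀ y₀ : E} (hx₀ : x₀ ∈ U) :
    Tendsto (fun q : E × E × 𝕜 => q.2.2⁻¹ • (f (q.1 + q.2.2 • q.2.1) - f q.1))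
      (𝓝 x₀ ×ˢ 𝓝 y₀ ×ˢ 𝓝[≠] 0) (𝓝 (df (x₀, y₀))) := by
  have := hF.topologicalAddGroup
  have := hF.continuousSMul
  let _ : Module ℝ F := Module.compHom F (algebraMap ℝ 𝕜)
  have hsm : ∀ (r : ℝ) (a : F), r • a = (algebraMap ℝ 𝕜 r) • a := fun _ _ => rfl
  have : LocallyConvexSpace ℝ F := hF.locallyConvex
  have : ContinuousSMul ℝ F := ⟨by
    simp only [hsm]
    have : Continuous (algebraMap ℝ 𝕜) := RCLike.continuous_ofReal
    fun_prop⟩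
  intro W hW
  obtain ⟨C, hC, hCW, hCc, hCx⟩ := exists_closed_convex_nhds hW
  have hm : Tendsto (fun q : E × E × 𝕜 => (q.1 + q.2.2 • q.2.1, q.2.1))
      (𝓝 x₀ ×ˢ 𝓝 y₀ ×ˢ 𝓝 0) (𝓝 (x₀, y₀)) := by
    have : Continuous fun q : E × E × 𝕜 => (q.1 + q.2.2 • q.2.1, q.2.1) := by fun_prop
    simpa [nhds_prod_eq] using this.tendsto (x₀, y₀, 0)
  have hopen : IsOpen (U ×ˢ (univ : Set E)) := hU.prod isOpen_univ
  have hnhds : U ×ˢ (univ : Set E) ∈ 𝓝 (x₀, y₀) := hopen.mem_nhds (mk_mem_prod hx₀ (mem_univ _))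
  have hN : ∀ᶠ p in 𝓝 (x₀, y₀), p.1 ∈ U ∧ df p ∈ C :=
    (show ∀ᶠ p in 𝓝 (x₀, y₀), p.1 ∈ U from mem_of_superset hnhds fun p hp => hp.1).and
      ((hc.continuousAt hnhds).eventually hC)
  obtain ⟨p₁, hp₁, p₂, hp₂, h₁⟩ := eventually_prod_iff.1 (hm.eventually hN)
  obtain ⟨p₃, hp₃, p₄, hp₄, h₂⟩ := eventually_prod_iff.1 hp₂
  obtain ⟨ε, hε, hb⟩ := Metric.eventually_nhds_iff_ball.1 hp₄
  have hball : ∀ᶠ t : 𝕜 in 𝓝[≠] 0, t ∈ Metric.ball 0 ε ∧ t ≠ 0 :=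
    inter_mem (nhdsWithin_le_nhds (Metric.ball_mem_nhds _ hε)) self_mem_nhdsWithin
  refine mem_map.2 ?_
  filter_upwards [prod_mem_prod hp₁ (prod_mem_prod hp₃ hball)]
  rintro ⟨x, y, t⟩ ⟨hx, hy, ht, ht0⟩
  refine hCW ?_
  -- The whole segment from `x` to `x + t • y` stays in the good neighbourhood, since the ball
  -- around `0` in `𝕜` contains `s * t` together with `t`.
  have key : ∀ s ∈ Icc (0 : ℝ) 1,
      x + (s : 𝕜) • t • y ∈ U ∧ df (x + (s : 𝕜) • t • y, y) ∈ C := by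
    intro s hs
    have hst : (s : 𝕜) * t ∈ Metric.ball (0 : 𝕜) ε := by
      rw [mem_ball_zero_iff] at ht ⊢
      rw [norm_mul, RCLike.norm_ofReal, abs_of_nonneg hs.1]
      exact (mul_le_of_le_one_left (norm_nonneg _) hs.2).trans_lt ht
    have := h₁ hx (h₂ hy (hb _ hst))
    simpa [smul_smul] using this
  -- The factor `t⁻¹` makes the increment of this curve over the unit interval the difference
  -- quotient itself, and its derivative the value of `df` in the unscaled direction `y`.
  have := sub_mem_of_deriv_mem (γ := fun s : ℝ => t⁻¹ • f (x + (s : 𝕜) • t • y))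
    (γ' := fun s : ℝ => df (x + (s : 𝕜) • t • y, y)) hCx hCc ?_ fun s hs => (key s hs).2
  · simpa [smul_sub] using this
  · intro s hs
    have hr : Tendsto (fun r : ℝ => (r : 𝕜) * t) (𝓝[≠] 0) (𝓝[≠] 0) := by
      refine tendsto_nhdsWithin_iff.2 ⟨?_, ?_⟩
      · have : Continuous fun r : ℝ => (r : 𝕜) * t := by fun_prop
        simpa using (this.tendsto 0).mono_left nhdsWithin_le_nhds
      · filter_upwards [self_mem_nhdsWithin] with r hr
        exact mul_ne_zero (by simpa using hr) ht0
    refine ((hd _ (key s hs).1 y).comp hr).congr fun r => ?_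
    simp only [Function.comp_apply, hsm, mul_inv]
    have h3 : x + (s : 𝕜) • t • y + ((r : 𝕜) * t) • y = x + ((s + r : ℝ) : 𝕜) • t • y := by
      rw [RCLike.ofReal_add, add_smul, smul_smul (r : 𝕜), add_assoc]
    rw [h3, ← smul_sub, mul_smul, RCLike.algebraMap_eq_ofReal, RCLike.ofReal_inv]

/-- The difference quotient of `f ∘ g` is one of `f` at `g x` in a moving direction, namely the
difference quotient of `g`, which tends to `l`. Uniformity of the convergence in the direction
suffices. -/
theorem HasDirectionalDeriv.comp {E F H : Type*} [AddCommGroup E] [Module 𝕜 E]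
    [AddCommGroup F] [Module 𝕜 F]
    [TopologicalSpace F] [IsTopologicalAddGroup F] [ContinuousSMul 𝕜 F]
    [AddCommGroup H] [Module 𝕜 H] [TopologicalSpace H] (hH : IsLocallyConvexTVS 𝕜 H)
    {f : F → H} {df : F × F → H} {V : Set F} (hV : IsOpen V)
    (hd : ∀ x ∈ V, ∀ y, HasDirectionalDeriv 𝕜 f (df (x, y)) x y)
    (hc : ContinuousOn df (V ×ˢ univ)) {g : E → F} {x y : E} {l : F} (hx : g x ∈ V)
    (hg : HasDirectionalDeriv 𝕜 g l x y) :
    HasDirectionalDeriv 𝕜 (f ∘ g) (df (g x, l)) x y := by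
  have h : Tendsto (fun t : 𝕜 => (g x, t⁻¹ • (g (x + t • y) - g x), t)) (𝓝[≠] 0)
      (𝓝 (g x) ×ˢ 𝓝 l ×ˢ 𝓝[≠] 0) :=
    tendsto_const_nhds.prodMk (Tendsto.prodMk hg tendsto_id)
  refine ((tendsto_difference_quotient hH hV hd hc hx).comp h).congr' ?_
  filter_upwards [self_mem_nhdsWithin] with t ht
  have ht : t ≠ 0 := ht
  simp [smul_smul, ht]

/-- Go from `x` to `x + t • y` and then on by `t • z`; the second difference quotient has a moving
base point, which `tendsto_difference_quotient` permits. -/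
theorem differential_add {E F : Type*} [AddCommGroup E] [Module 𝕜 E]
    [TopologicalSpace E] [IsTopologicalAddGroup E] [ContinuousSMul 𝕜 E]
    [AddCommGroup F] [Module 𝕜 F] [TopologicalSpace F] [T2Space F] (hF : IsLocallyConvexTVS 𝕜 F)
    {f : E → F} {df : E × E → F} {U : Set E} (hU : IsOpen U)
    (hd : ∀ x ∈ U, ∀ y, HasDirectionalDeriv 𝕜 f (df (x, y)) x y)
    (hc : ContinuousOn df (U ×ˢ univ)) {x : E} (hx : x ∈ U) (y z : E) :
    df (x, y + z) = df (x, y) + df (x, z) := by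
  have := hF.topologicalAddGroup
  have h : Tendsto (fun t : 𝕜 => (x + t • y, z, t)) (𝓝[≠] 0) (𝓝 x ×ˢ 𝓝 z ×ˢ 𝓝[≠] 0) := by
    exact (tendsto_add_smul_nhds x y).prodMk (tendsto_const_nhds.prodMk tendsto_id)
  refine tendsto_nhds_unique (hd x hx (y + z)) ?_
  refine (((hd x hx y).add ((tendsto_difference_quotient hF hU hd hc hx).comp h))).congr
    fun t => ?_
  simp only [Function.comp_apply, ← smul_add, add_assoc]
  congr 1
  abel

theorem differential_smul {E F : Type*} [AddCommGroup E] [Module 𝕜 E]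
    [AddCommGroup F] [Module 𝕜 F] [TopologicalSpace F] [T2Space F] [ContinuousSMul 𝕜 F]
    {f : E → F} {df : E × E → F} {U : Set E}
    (hd : ∀ x ∈ U, ∀ y, HasDirectionalDeriv 𝕜 f (df (x, y)) x y) {x : E} (hx : x ∈ U)
    (c : 𝕜) (y : E) : df (x, c • y) = c • df (x, y) :=
  tendsto_nhds_unique (hd x hx (c • y)) ((hd x hx y).smul_direction c)

variable (𝕜) in
/-- The directional derivative of `f` at `p.1` in the direction `p.2`, if it exists. -/
noncomputable def dirDeriv {E F : Type*} [AddCommGroup E] [Module 𝕜 E]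
    [AddCommGroup F] [Module 𝕜 F] [TopologicalSpace F] (f : E → F) (p : E × E) : F :=
  limUnder (𝓝[≠] (0 : 𝕜)) fun t => t⁻¹ • (f (p.1 + t • p.2) - f p.1)

theorem HasDirectionalDeriv.dirDeriv_eq {E F : Type*} [AddCommGroup E] [Module 𝕜 E]
    [AddCommGroup F] [Module 𝕜 F] [TopologicalSpace F] [T2Space F] {f : E → F} {l : F} {x y : E}
    (h : HasDirectionalDeriv 𝕜 f l x y) : dirDeriv 𝕜 f (x, y) = l :=
  Tendsto.limUnder_eq h

theorem HasDirectionalDeriv.hasDirectionalDeriv_dirDeriv {E F : Type*} [AddCommGroup E]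
    [Module 𝕜 E] [AddCommGroup F] [Module 𝕜 F] [TopologicalSpace F] [T2Space F]
    {f : E → F} {l : F} {x y : E}
    (h : HasDirectionalDeriv 𝕜 f l x y) : HasDirectionalDeriv 𝕜 f (dirDeriv 𝕜 f (x, y)) x y := by
  rwa [h.dirDeriv_eq]

theorem dirDeriv_congr {E F : Type*} [AddCommGroup E] [Module 𝕜 E]
    [TopologicalSpace E] [IsTopologicalAddGroup E] [ContinuousSMul 𝕜 E]
    [AddCommGroup F] [Module 𝕜 F] [TopologicalSpace F] {f g : E → F} {x y : E}
    (hfg : f =ᶠ[𝓝 x] g) : dirDeriv 𝕜 f (x, y) = dirDeriv 𝕜 g (x, y) := by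
  unfold dirDeriv limUnder
  refine congrArg _ (map_congr ?_)
  filter_upwards [(tendsto_add_smul_nhds x y).eventually hfg] with t ht
  simp only [ht, hfg.eq_of_nhds]

variable (𝕜) in
/-- `f` is of class `C^k` over `𝕜` on the open set `U`: it is continuous, and if `k > 0` its
differential `U × E → F` exists and is of class `C^(k - 1)`. -/
def IsCkOn : ℕ → ∀ {E : Type u} {F : Type v} [AddCommGroup E] [Module 𝕜 E] [TopologicalSpace E]
    [AddCommGroup F] [Module 𝕜 F] [TopologicalSpace F], (E → F) → Set E → Prop
  | 0, _, _, _, _, _, _, _, _, f, U => ContinuousOn f U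
  | k + 1, _, _, _, _, _, _, _, _, f, U => ContinuousOn f U ∧
      (∀ x ∈ U, ∀ y, HasDirectionalDeriv 𝕜 f (dirDeriv 𝕜 f (x, y)) x y) ∧
      IsCkOn k (dirDeriv 𝕜 f) (U ×ˢ univ)

theorem IsCkOn.continuousOn {k : ℕ} {E : Type u} {F : Type v} [AddCommGroup E] [Module 𝕜 E]
    [TopologicalSpace E] [AddCommGroup F] [Module 𝕜 F] [TopologicalSpace F] {f : E → F} {U : Set E}
    (h : IsCkOn 𝕜 k f U) : ContinuousOn f U := by
  cases k with
  | zero => exact h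
  | succ k => exact h.1

theorem IsCkOn.mono : ∀ (k : ℕ) {E : Type u} {F : Type v} [AddCommGroup E] [Module 𝕜 E]
    [TopologicalSpace E] [AddCommGroup F] [Module 𝕜 F] [TopologicalSpace F] {f : E → F}
    {U V : Set E}, IsCkOn 𝕜 k f U → V ⊆ U → IsCkOn 𝕜 k f V
  | 0, _, _, _, _, _, _, _, _, _, _, _, h, hVU => ContinuousOn.mono h hVU
  | k + 1, _, _, _, _, _, _, _, _, _, _, _, h, hVU =>
    ⟨h.1.mono hVU, fun x hx => h.2.1 x (hVU hx), IsCkOn.mono k h.2.2 (prod_mono_left hVU)⟩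

theorem IsCkOn.congr : ∀ (k : ℕ) {E : Type u} {F : Type v} [AddCommGroup E] [Module 𝕜 E]
    [TopologicalSpace E] [IsTopologicalAddGroup E] [ContinuousSMul 𝕜 E]
    [AddCommGroup F] [Module 𝕜 F] [TopologicalSpace F] {f g : E → F}
    {U : Set E}, IsOpen U → IsCkOn 𝕜 k f U → EqOn g f U → IsCkOn 𝕜 k g U
  | 0, _, _, _, _, _, _, _, _, _, _, _, _, _, _, h, hfg => ContinuousOn.congr h hfg
  | k + 1, _, _, _, _, _, _, _, _, _, _, f, g, U, hU, h, hfg => by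
    have hev : ∀ x ∈ U, g =ᶠ[𝓝 x] f := fun x hx => hfg.eventuallyEq_of_mem (hU.mem_nhds hx)
    refine ⟨h.1.congr hfg, fun x hx y => ?_,
      IsCkOn.congr k (hU.prod isOpen_univ) h.2.2 fun p hp => dirDeriv_congr (hev _ hp.1)⟩
    rw [dirDeriv_congr (hev x hx)]
    exact (h.2.1 x hx y).congr (hev x hx)

theorem IsCkOn.of_locally : ∀ (k : ℕ) {E : Type u} {F : Type v} [AddCommGroup E] [Module 𝕜 E]
    [TopologicalSpace E] [AddCommGroup F] [Module 𝕜 F] [TopologicalSpace F] {f : E → F}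
    {U : Set E}, (∀ x ∈ U, ∃ V, IsOpen V ∧ x ∈ V ∧ IsCkOn 𝕜 k f V) → IsCkOn 𝕜 k f U
  | 0, _, _, _, _, _, _, _, _, _, _, h => fun x hx => by
    obtain ⟨V, hV, hxV, hf⟩ := h x hx
    exact (ContinuousOn.continuousAt hf (hV.mem_nhds hxV)).continuousWithinAt
  | k + 1, _, _, _, _, _, _, _, _, _, _, h => by
    refine ⟨fun x hx => ?_, fun x hx => ?_, IsCkOn.of_locally k fun p hp => ?_⟩
    · obtain ⟨V, hV, hxV, hf⟩ := h x hx
      exact (hf.1.continuousAt (hV.mem_nhds hxV)).continuousWithinAt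
    · obtain ⟨V, hV, hxV, hf⟩ := h x hx
      exact hf.2.1 x hxV
    · obtain ⟨V, hV, hxV, hf⟩ := h p.1 hp.1
      exact ⟨V ×ˢ univ, hV.prod isOpen_univ, ⟨hxV, mem_univ _⟩, hf.2.2⟩

/-- Limits in `F` are unique, so an explicit formula for the differential agrees with `dirDeriv`.
Inductions on `k` can therefore use formulas. -/
theorem IsCkOn.of_hasDirectionalDeriv {k : ℕ} {E : Type u} {F : Type v} [AddCommGroup E]
    [Module 𝕜 E] [TopologicalSpace E] [IsTopologicalAddGroup E] [ContinuousSMul 𝕜 E]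
    [AddCommGroup F] [Module 𝕜 F] [TopologicalSpace F] [T2Space F] {f : E → F} {df : E × E → F}
    {U : Set E} (hU : IsOpen U) (hf : ContinuousOn f U)
    (hd : ∀ x ∈ U, ∀ y, HasDirectionalDeriv 𝕜 f (df (x, y)) x y)
    (h : IsCkOn 𝕜 k df (U ×ˢ univ)) : IsCkOn 𝕜 (k + 1) f U :=
  ⟨hf, fun x hx y => (hd x hx y).hasDirectionalDeriv_dirDeriv,
    h.congr k (hU.prod isOpen_univ) fun p hp => (hd p.1 hp.1 p.2).dirDeriv_eq⟩

theorem isCkOn_const : ∀ (k : ℕ) {E : Type u} {F : Type v} [AddCommGroup E] [Module 𝕜 E]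
    [TopologicalSpace E] [IsTopologicalAddGroup E] [ContinuousSMul 𝕜 E]
    [AddCommGroup F] [Module 𝕜 F] [TopologicalSpace F] [T2Space F] (c : F),
    IsCkOn 𝕜 k (fun _ : E => c) univ
  | 0, _, _, _, _, _, _, _, _, _, _, _, _ => continuousOn_const
  | k + 1, _, F, _, _, _, _, _, _, _, _, _, c => by
    refine IsCkOn.of_hasDirectionalDeriv (df := fun _ => 0) isOpen_univ continuousOn_const
      (fun x _ y => ?_) ?_
    · simp [HasDirectionalDeriv]
    · exact (isCkOn_const k (0 : F)).mono k (subset_univ _)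

theorem ContinuousLinearMap.hasDirectionalDeriv {E F : Type*} [AddCommGroup E] [Module 𝕜 E]
    [TopologicalSpace E] [AddCommGroup F] [Module 𝕜 F] [TopologicalSpace F] (l : E →L[𝕜] F)
    (x y : E) : HasDirectionalDeriv 𝕜 l (l y) x y := by
  refine tendsto_const_nhds.congr' ?_
  filter_upwards [self_mem_nhdsWithin] with t ht
  have ht : t ≠ 0 := ht
  simp [smul_smul, ht]

theorem ContinuousLinearMap.isCkOn : ∀ (k : ℕ) {E : Type u} {F : Type v} [AddCommGroup E]
    [Module 𝕜 E] [TopologicalSpace E] [IsTopologicalAddGroup E] [ContinuousSMul 𝕜 E]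
    [AddCommGroup F] [Module 𝕜 F] [TopologicalSpace F] [T2Space F] (l : E →L[𝕜] F) (U : Set E),
    IsCkOn 𝕜 k l U
  | 0, _, _, _, _, _, _, _, _, _, _, _, l, _ => l.continuous.continuousOn
  | k + 1, E, _, _, _, _, _, _, _, _, _, _, l, _ =>
    (IsCkOn.of_hasDirectionalDeriv (df := l.comp (ContinuousLinearMap.snd 𝕜 E E)) isOpen_univ
      l.continuous.continuousOn (fun x _ y => l.hasDirectionalDeriv x y)
      (ContinuousLinearMap.isCkOn k _ _)).mono (k + 1) (subset_univ _)

/-- The differential is `dirDeriv 𝕜 f` composed with `l × l`, again of the same shape, so the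
induction closes without the mean value theorem and without local convexity. -/
theorem IsCkOn.comp_continuousLinearMap : ∀ (k : ℕ) {E : Type u} {F : Type v} {H : Type w}
    [AddCommGroup E] [Module 𝕜 E] [TopologicalSpace E] [IsTopologicalAddGroup E]
    [ContinuousSMul 𝕜 E] [AddCommGroup F] [Module 𝕜 F]
    [TopologicalSpace F] [AddCommGroup H] [Module 𝕜 H] [TopologicalSpace H] [T2Space H]
    {f : F → H} {V : Set F} {U : Set E}, IsOpen U → IsCkOn 𝕜 k f V → ∀ (l : E →L[𝕜] F),
    MapsTo l U V → IsCkOn 𝕜 k (fun x => f (l x)) U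
  | 0, _, _, _, _, _, _, _, _, _, _, _, _, _, _, _, _, _, _, _, h, l, hl =>
    ContinuousOn.comp h l.continuous.continuousOn hl
  | k + 1, E, F, _, _, _, _, _, _, _, _, _, _, _, _, _, f, V, U, hU, h, l, hl => by
    refine IsCkOn.of_hasDirectionalDeriv
      (df := fun p => dirDeriv 𝕜 f (l.prodMap l p)) hU
      (h.1.comp l.continuous.continuousOn hl) (fun x hx y => ?_)
      (IsCkOn.comp_continuousLinearMap k (hU.prod isOpen_univ) h.2.2 _
        fun p hp => ⟨hl hp.1, mem_univ _⟩)
    simpa [HasDirectionalDeriv] using h.2.1 (l x) (hl hx) (l y)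

theorem IsCkOn.prodMk : ∀ (k : ℕ) {E : Type u} {F : Type v} {H : Type w}
    [AddCommGroup E] [Module 𝕜 E] [TopologicalSpace E] [IsTopologicalAddGroup E]
    [ContinuousSMul 𝕜 E] [AddCommGroup F] [Module 𝕜 F]
    [TopologicalSpace F] [T2Space F] [AddCommGroup H] [Module 𝕜 H] [TopologicalSpace H]
    [T2Space H] {f : E → F} {g : E → H} {U : Set E}, IsOpen U → IsCkOn 𝕜 k f U → IsCkOn 𝕜 k g U →
    IsCkOn 𝕜 k (fun x => (f x, g x)) U
  | 0, _, _, _, _, _, _, _, _, _, _, _, _, _, _, _, _, _, _, _, _, hf, hg =>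
    ContinuousOn.prodMk hf hg
  | k + 1, _, _, _, _, _, _, _, _, _, _, _, _, _, _, _, _, f, g, _, hU, hf, hg =>
    IsCkOn.of_hasDirectionalDeriv (df := fun p => (dirDeriv 𝕜 f p, dirDeriv 𝕜 g p)) hU
      (hf.1.prodMk hg.1) (fun x hx y => Tendsto.prodMk_nhds (hf.2.1 x hx y) (hg.2.1 x hx y))
      (IsCkOn.prodMk k (hU.prod isOpen_univ) hf.2.2 hg.2.2)

theorem IsCkOn.add : ∀ (k : ℕ) {E : Type u} {F : Type v}
    [AddCommGroup E] [Module 𝕜 E] [TopologicalSpace E] [IsTopologicalAddGroup E]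
    [ContinuousSMul 𝕜 E] [AddCommGroup F] [Module 𝕜 F]
    [TopologicalSpace F] [T2Space F] [IsTopologicalAddGroup F] {f g : E → F} {U : Set E},
    IsOpen U → IsCkOn 𝕜 k f U → IsCkOn 𝕜 k g U → IsCkOn 𝕜 k (fun x => f x + g x) U
  | 0, _, _, _, _, _, _, _, _, _, _, _, _, _, _, _, _, hf, hg => ContinuousOn.add hf hg
  | k + 1, _, _, _, _, _, _, _, _, _, _, _, _, f, g, _, hU, hf, hg =>
    IsCkOn.of_hasDirectionalDeriv (df := fun p => dirDeriv 𝕜 f p + dirDeriv 𝕜 g p) hU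
      (hf.1.add hg.1) (fun x hx y => (Tendsto.add (hf.2.1 x hx y) (hg.2.1 x hx y)).congr fun t => by
        rw [← smul_add, add_sub_add_comm])
      (IsCkOn.add k (hU.prod isOpen_univ) hf.2.2 hg.2.2)

theorem IsCkOn.sum (k : ℕ) {E : Type u} {F : Type v}
    [AddCommGroup E] [Module 𝕜 E] [TopologicalSpace E] [IsTopologicalAddGroup E]
    [ContinuousSMul 𝕜 E] [AddCommGroup F] [Module 𝕜 F]
    [TopologicalSpace F] [T2Space F] [IsTopologicalAddGroup F] {ι : Type*} (s : Finset ι)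
    {f : ι → E → F} {U : Set E} (hU : IsOpen U) (hf : ∀ i, IsCkOn 𝕜 k (f i) U) :
    IsCkOn 𝕜 k (fun x => ∑ i ∈ s, f i x) U := by
  classical
  induction s using Finset.induction_on with
  | empty => simpa using (isCkOn_const k (0 : F)).mono k (subset_univ U)
  | insert a s ha ih =>
    simp only [Finset.sum_insert ha]
    exact (hf a).add k hU ih

theorem IsCkOn.of_succ : ∀ (k : ℕ) {E : Type u} {F : Type v} [AddCommGroup E] [Module 𝕜 E]
    [TopologicalSpace E] [AddCommGroup F] [Module 𝕜 F] [TopologicalSpace F] {f : E → F}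
    {U : Set E}, IsCkOn 𝕜 (k + 1) f U → IsCkOn 𝕜 k f U
  | 0, _, _, _, _, _, _, _, _, _, _, h => h.1
  | k + 1, _, _, _, _, _, _, _, _, _, _, h => ⟨h.1, h.2.1, IsCkOn.of_succ k h.2.2⟩

/-- The chain rule for `C^k`-maps. -/
theorem IsCkOn.comp : ∀ (k : ℕ) {E : Type u} {F : Type v} {H : Type w}
    [AddCommGroup E] [Module 𝕜 E] [TopologicalSpace E] [IsTopologicalAddGroup E]
    [ContinuousSMul 𝕜 E] [AddCommGroup F] [Module 𝕜 F]
    [TopologicalSpace F] [IsTopologicalAddGroup F] [ContinuousSMul 𝕜 F] [T2Space F]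
    [AddCommGroup H] [Module 𝕜 H] [TopologicalSpace H] [T2Space H] (_ : IsLocallyConvexTVS 𝕜 H)
    {f : F → H} {g : E → F} {V : Set F} {U : Set E}, IsOpen V → IsOpen U → IsCkOn 𝕜 k f V →
    IsCkOn 𝕜 k g U → MapsTo g U V → IsCkOn 𝕜 k (fun x => f (g x)) U
  | 0, _, _, _, _, _, _, _, _, _, _, _, _, _, _, _, _, _, _, _, _, _, _, _, _, _, hf, hg, hm =>
    ContinuousOn.comp hf hg hm
  | k + 1, E, F, _, _, _, _, _, _, _, _, _, _, _, _, _, _, _, _, hH, f, g, V, U, hV, hU, hf, hg,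
      hm => by
    refine IsCkOn.of_hasDirectionalDeriv
      (df := fun p => dirDeriv 𝕜 f (g p.1, dirDeriv 𝕜 g p)) hU (hf.1.comp hg.1 hm)
      (fun x hx y => (hg.2.1 x hx y).comp hH hV hf.2.1 hf.2.2.continuousOn (hm hx)) ?_
    -- The formula for the differential is itself a composition of `C^k`-maps, so the induction
    -- hypothesis applies to it.
    refine IsCkOn.comp k hH (hV.prod isOpen_univ) (hU.prod isOpen_univ) hf.2.2 ?_
      fun p hp => ⟨hm hp.1, mem_univ _⟩
    exact IsCkOn.prodMk k (hU.prod isOpen_univ)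
      (IsCkOn.comp_continuousLinearMap k (hU.prod isOpen_univ) (hg.of_succ k)
        (ContinuousLinearMap.fst 𝕜 E E) fun p hp => hp.1) hg.2.2

end Calculus

/-! ### Iterated directional derivatives versus recursive `C^k` -/

section IteratedDerivatives

variable {𝕜 : Type*} [RCLike 𝕜] {E : Type u} {F : Type v} [AddCommGroup E] [Module 𝕜 E]
  [TopologicalSpace E] [IsTopologicalAddGroup E] [ContinuousSMul 𝕜 E]
  [AddCommGroup F] [Module 𝕜 F] [TopologicalSpace F]

/-- The directional derivatives of `(x, ys) ↦ M x ys` for a map which is multilinear in `ys`. -/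
theorem hasDirectionalDeriv_multilinear [IsTopologicalAddGroup F] [ContinuousSMul 𝕜 F]
    {U : Set E} (hU : IsOpen U) {k : ℕ} {g : E → (Fin k → E) → F}
    (hM : ∀ x ∈ U, ∃ M : MultilinearMap 𝕜 (fun _ : Fin k => E) F, ∀ ys, M ys = g x ys)
    (hc : ContinuousOn (fun p : E × (Fin k → E) => g p.1 p.2) (U ×ˢ univ))
    {x : E} (hx : x ∈ U) {y : E} {ys zs : Fin k → E} {l : F}
    (hd : HasDirectionalDeriv 𝕜 (fun z => g z ys) l x y) :
    HasDirectionalDeriv 𝕜 (fun p : E × (Fin k → E) => g p.1 p.2)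
      (l + ∑ i, g x (Function.update ys i (zs i))) (x, ys) (y, zs) := by
  have hev : ∀ᶠ t : 𝕜 in 𝓝[≠] 0, x + t • y ∈ U :=
    (tendsto_add_smul_nhds x y).eventually (hU.mem_nhds hx)
  -- Move the base point first and then the directions one at a time; `s` is the set of directions
  -- already moved.
  have key : ∀ s : Finset (Fin k),
      Tendsto (fun t : 𝕜 => t⁻¹ • (g (x + t • y) (s.piecewise (ys + t • zs) ys) - g x ys)) (𝓝[≠] 0)
        (𝓝 (l + ∑ i ∈ s, g x (Function.update ys i (zs i)))) := by
    intro s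
    induction s using Finset.induction_on with
    | empty => simpa [HasDirectionalDeriv] using hd
    | insert a s ha ih =>
      -- By multilinearity at `x + t • y`, moving coordinate `a` adds `t` times the value at this
      -- point; joint continuity of `g` gives the limit.
      have hw : Tendsto (fun t : 𝕜 => (x + t • y,
          Function.update (s.piecewise (ys + t • zs) ys) a (zs a))) (𝓝[≠] 0)
          (𝓝 (x, Function.update ys a (zs a))) := by
        refine (tendsto_add_smul_nhds x y).prodMk_nhds ?_
        have h1 : Tendsto (fun t : 𝕜 => s.piecewise (ys + t • zs) ys) (𝓝[≠] 0) (𝓝 ys) := by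
          refine tendsto_pi_nhds.2 fun i => ?_
          by_cases hi : i ∈ s
          · simpa [hi] using tendsto_add_smul_nhds (𝕜 := 𝕜) (ys i) (zs i)
          · simpa [hi] using tendsto_const_nhds
        exact h1.update a tendsto_const_nhds
      have hg := ((hc.continuousAt ((hU.prod isOpen_univ).mem_nhds
        ⟨hx, mem_univ _⟩)).tendsto).comp hw
      rw [Finset.sum_insert ha, add_comm (g x _), ← add_assoc]
      refine (ih.add hg).congr' ?_
      filter_upwards [hev, self_mem_nhdsWithin] with t ht ht0
      have ht0 : t ≠ 0 := ht0
      obtain ⟨M, hM⟩ := hM _ ht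
      simp only [Function.comp_apply, ← hM]
      rw [Finset.piecewise_insert, Pi.add_apply, Pi.smul_apply, MultilinearMap.map_update_add,
        MultilinearMap.map_update_smul]
      have : Function.update (s.piecewise (ys + t • zs) ys) a (ys a) =
          s.piecewise (ys + t • zs) ys := by
        rw [Function.update_eq_self_iff]
        simp [ha]
      rw [this, add_sub_right_comm, smul_add, smul_smul, inv_mul_cancel₀ ht0, one_smul]
  simpa [HasDirectionalDeriv] using key Finset.univ

variable [T2Space F]

/-- The iterated directional derivatives of a `C^∞`-map are multilinear in the directions. -/
theorem iteratedDirectionalDeriv_multilinear (hF : IsLocallyConvexTVS 𝕜 F)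
    {f : E → F} {U : Set E} (hU : IsOpen U) {d : (k : ℕ) → E → (Fin k → E) → F}
    (h0 : ∀ x ∈ U, ∀ ys, d 0 x ys = f x)
    (hd : ∀ k, ∀ x ∈ U, ∀ (y : E) (ys : Fin k → E),
      HasDirectionalDeriv 𝕜 (fun z => d k z ys) (d (k + 1) x (Matrix.vecCons y ys)) x y)
    (hc : ∀ k, ContinuousOn (fun p : E × (Fin k → E) => d k p.1 p.2) (U ×ˢ univ)) (k : ℕ) :
    ∀ x ∈ U, ∃ M : MultilinearMap 𝕜 (fun _ : Fin k => E) F, ∀ ys, M ys = d k x ys := by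
  have := hF.topologicalAddGroup
  have := hF.continuousSMul
  induction k with
  | zero =>
    intro x hx
    exact ⟨MultilinearMap.constOfIsEmpty 𝕜 _ (f x), fun ys => (h0 x hx ys).symm⟩
  | succ k ih =>
    intro x hx
    have hdf : ∀ ys : Fin k → E,
        ContinuousOn (fun p : E × E => d (k + 1) p.1 (Matrix.vecCons p.2 ys)) (U ×ˢ univ) := by
      intro ys
      have hcont : Continuous fun p : E × E => (p.1, (Matrix.vecCons p.2 ys : Fin (k + 1) → E)) := by
        fun_prop
      exact (hc (k + 1)).comp hcont.continuousOn fun p hp => ⟨hp.1, mem_univ _⟩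
    have hzero : ∀ (m : Fin (k + 1) → E) (c : E),
        Function.update m 0 c = Matrix.vecCons c (Fin.tail m) := by
      intro m c
      rw [← Fin.cons_self_tail m, Fin.update_cons_zero]
      rfl
    have hsucc : ∀ (m : Fin (k + 1) → E) (i : Fin k) (c : E),
        Function.update m i.succ c =
          Matrix.vecCons (m 0) (Function.update (Fin.tail m) i c) := by
      intro m i c
      conv_lhs => rw [← Fin.cons_self_tail m, ← Fin.cons_update]
      rfl
    have hev : ∀ y : E, ∀ᶠ t : 𝕜 in 𝓝[≠] 0, x + t • y ∈ U := fun y =>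
      (tendsto_add_smul_nhds x y).eventually (hU.mem_nhds hx)
    -- In slot `0`, the newest direction, linearity is that of a differential. In the other slots it
    -- passes to the limit from the difference quotients of `d k`.
    refine ⟨MultilinearMap.mk' (d (k + 1) x) (fun m i => ?_) (fun m i => ?_), fun ys => rfl⟩
    · refine Fin.cases ?_ (fun i => ?_) i
      · intro a b
        simp only [hzero]
        exact differential_add hF hU (fun x hx y => hd k x hx y _) (hdf _) hx a b
      · intro a b
        simp only [hsucc]
        refine tendsto_nhds_unique (hd k x hx _ _) (((hd k x hx _ _).add (hd k x hx _ _)).congr' ?_)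
        filter_upwards [hev (m 0)] with t ht
        obtain ⟨M, hM⟩ := ih _ hx
        obtain ⟨N, hN⟩ := ih _ ht
        simp only [← hM, ← hN, MultilinearMap.map_update_add]
        rw [← smul_add, add_sub_add_comm]
    · refine Fin.cases ?_ (fun i => ?_) i
      · intro c a
        simp only [hzero]
        exact differential_smul (df := fun p : E × E => d (k + 1) p.1 (Matrix.vecCons p.2 _))
          (fun x hx y => hd k x hx y _) hx c a
      · intro c a
        simp only [hsucc]
        refine tendsto_nhds_unique (hd k x hx _ _) (((hd k x hx _ _).const_smul c).congr' ?_)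
        filter_upwards [hev (m 0)] with t ht
        obtain ⟨M, hM⟩ := ih _ hx
        obtain ⟨N, hN⟩ := ih _ ht
        simp only [← hM, ← hN, MultilinearMap.map_update_smul]
        rw [← smul_sub, smul_comm]

/-- The induction needs all `d m` at once, as functions of `(x, ys)` jointly: by multilinearity, the
differential of `d m` is `d (m + 1)` plus terms of `d m` with one direction exchanged, each
precomposed with a continuous linear map. -/
theorem IsCInftyOn.isCkOn (hF : IsLocallyConvexTVS 𝕜 F)
    {f : E → F} {U : Set E} (hU : IsOpen U) (h : IsCInftyOn 𝕜 f U) (k : ℕ) : IsCkOn 𝕜 k f U := by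
  obtain ⟨d, h0, hd, hc⟩ := h
  have := hF.topologicalAddGroup
  have := hF.continuousSMul
  have hM := iteratedDirectionalDeriv_multilinear hF hU h0 hd hc
  have key : ∀ k m : ℕ, IsCkOn 𝕜 k (fun p : E × (Fin m → E) => d m p.1 p.2) (U ×ˢ univ) := by
    intro k
    induction k with
    | zero => exact fun m => hc m
    | succ k ih =>
      intro m
      refine IsCkOn.of_hasDirectionalDeriv (df := fun q => d (m + 1) q.1.1
          (Matrix.vecCons q.2.1 q.1.2) + ∑ i, d m q.1.1 (Function.update q.1.2 i (q.2.2 i)))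
        (hU.prod isOpen_univ) (hc m) (fun p hp q => ?_) ?_
      · exact hasDirectionalDeriv_multilinear hU (hM m) (hc m) hp.1 (hd m p.1 hp.1 q.1 p.2)
      · have hO : IsOpen ((U ×ˢ (univ : Set (Fin m → E))) ×ˢ (univ : Set (E × (Fin m → E)))) :=
          (hU.prod isOpen_univ).prod isOpen_univ
        refine IsCkOn.add k hO ?_ (IsCkOn.sum k _ hO fun i => ?_)
        · let l : (E × (Fin m → E)) × (E × (Fin m → E)) →L[𝕜] E × (Fin (m + 1) → E) :=
            { toFun := fun q => (q.1.1, Matrix.vecCons q.2.1 q.1.2)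
              map_add' := fun p q => by simp
              map_smul' := fun c q => by simp
              cont := by fun_prop }
          exact IsCkOn.comp_continuousLinearMap k hO (ih (m + 1)) l fun p hp => ⟨hp.1.1, mem_univ _⟩
        · let l : (E × (Fin m → E)) × (E × (Fin m → E)) →L[𝕜] E × (Fin m → E) :=
            { toFun := fun q => (q.1.1, Function.update q.1.2 i (q.2.2 i))
              map_add' := fun p q => by simp [Function.update_add]
              map_smul' := fun c q => by simp [Function.update_smul]
              cont := by fun_prop }
          exact IsCkOn.comp_continuousLinearMap k hO (ih m) l fun p hp => ⟨hp.1.1, mem_univ _⟩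
  let l : E →L[𝕜] E × (Fin 0 → E) := ContinuousLinearMap.inl 𝕜 _ _
  exact (IsCkOn.comp_continuousLinearMap k hU (key k 0) l fun x hx => ⟨hx, mem_univ _⟩).congr k hU
    fun x hx => (h0 x hx _).symm

/-- The next iterated derivative is the differential of `(x, ys) ↦ d k x ys` in the direction `(y,
0)`. Each step uses up one order of differentiability, so the induction carries `C^m` for all `m`.
-/
theorem isCInftyOn_of_isCkOn {f : E → F} {U : Set E} (hU : IsOpen U)
    (h : ∀ k, IsCkOn 𝕜 k f U) : IsCInftyOn 𝕜 f U := by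
  let d : (k : ℕ) → E → (Fin k → E) → F := fun k => Nat.rec (fun x _ => f x)
    (fun k dk x ys => dirDeriv 𝕜 (fun z => dk z (Fin.tail ys)) (x, ys 0)) k
  have hsucc : ∀ k x y (ys : Fin k → E),
      d (k + 1) x (Matrix.vecCons y ys) = dirDeriv 𝕜 (fun z => d k z ys) (x, y) :=
    fun _ _ _ _ => rfl
  have hsucc' : ∀ k x (ys : Fin (k + 1) → E),
      d (k + 1) x ys = dirDeriv 𝕜 (fun z => d k z (Fin.tail ys)) (x, ys 0) := fun _ _ _ => rfl
  have key : ∀ k m, IsCkOn 𝕜 m (fun p : E × (Fin k → E) => d k p.1 p.2) (U ×ˢ univ) := by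
    intro k
    induction k with
    | zero =>
      exact fun m => IsCkOn.comp_continuousLinearMap m (hU.prod isOpen_univ) (h m)
        (ContinuousLinearMap.fst 𝕜 E (Fin 0 → E)) fun p hp => hp.1
    | succ k ih =>
      intro m
      let l : E × (Fin (k + 1) → E) →L[𝕜] (E × (Fin k → E)) × (E × (Fin k → E)) :=
        { toFun := fun p => ((p.1, Fin.tail p.2), (p.2 0, 0))
          map_add' := fun p q => by simp [Fin.tail_def]; rfl
          map_smul' := fun c q => by simp [Fin.tail_def]; rfl
          cont := by
            simp only [Fin.tail_def]
            fun_prop }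
      refine (IsCkOn.comp_continuousLinearMap m (hU.prod isOpen_univ) (ih (m + 1)).2.2 l
        fun p hp => ⟨⟨hp.1, mem_univ _⟩, mem_univ _⟩).congr m (hU.prod isOpen_univ) fun p hp => ?_
      simp [l, hsucc', dirDeriv]
  refine ⟨d, fun _ _ _ => rfl, fun k x hx y ys => ?_, fun k => (key k 0).continuousOn⟩
  rw [hsucc]
  have := (key k 1).2.1 (x, ys) ⟨hx, mem_univ _⟩ (y, 0)
  have hy : HasDirectionalDeriv 𝕜 (fun z => d k z ys)
      (dirDeriv 𝕜 (fun p : E × (Fin k → E) => d k p.1 p.2) ((x, ys), (y, 0))) x y := by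
    simpa [HasDirectionalDeriv] using this
  exact hy.hasDirectionalDeriv_dirDeriv

end IteratedDerivatives

/-! ### Smoothness at a point, expressed in charts -/

theorem OpenPartialHomeomorph.eventually_symm_nhds {X Y : Type*} [TopologicalSpace X]
    [TopologicalSpace Y] (e : OpenPartialHomeomorph X Y) {Q : X → Prop} {p : X}
    (hp : p ∈ e.source) (h : ∀ᶠ x in 𝓝 p, Q x) : ∀ᶠ x in 𝓝 (e p), Q (e.symm x) :=
  (e.tendsto_symm hp).eventually h

theorem isOpen_chart_domain {X X' Y Y' : Type*} [TopologicalSpace X] [TopologicalSpace X']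
    [TopologicalSpace Y] [TopologicalSpace Y'] {f : X → X'} (hf : Continuous f)
    (e : OpenPartialHomeomorph X Y) (e' : OpenPartialHomeomorph X' Y') :
    IsOpen (e.target ∩ e.symm ⁻¹' (f ⁻¹' e'.source)) :=
  e.isOpen_inter_preimage_symm (e'.open_source.preimage hf)

section SmoothAt

variable {𝕜 : Type*} [RCLike 𝕜]
  {E : Type u} [AddCommGroup E] [Module 𝕜 E] [TopologicalSpace E]
  {F : Type v} [AddCommGroup F] [Module 𝕜 F] [TopologicalSpace F]
  {H : Type w} [AddCommGroup H] [Module 𝕜 H] [TopologicalSpace H]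
  {M N P : Type*} [TopologicalSpace M] [TopologicalSpace N] [TopologicalSpace P]

variable (𝕜) in
/-- The expression of `f` in the charts `e` and `e'` is `C^∞` on a neighbourhood of `e p`. -/
def IsSmoothAt (e : OpenPartialHomeomorph M E) (e' : OpenPartialHomeomorph N F) (f : M → N)
    (p : M) : Prop :=
  ∃ W, IsOpen W ∧ e p ∈ W ∧ ∀ k, IsCkOn 𝕜 k (e' ∘ f ∘ e.symm) W

variable {e : OpenPartialHomeomorph M E} {e' : OpenPartialHomeomorph N F}
  {e'' : OpenPartialHomeomorph P H} {f g : M → N} {p : M}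

variable [IsTopologicalAddGroup E] [ContinuousSMul 𝕜 E]

theorem IsSmoothAt.of_eventuallyEq {φ : E → F} (h : ∃ W, IsOpen W ∧ e p ∈ W ∧ ∀ k, IsCkOn 𝕜 k φ W)
    (hfg : ∀ᶠ x in 𝓝 (e p), e' (f (e.symm x)) = φ x) : IsSmoothAt 𝕜 e e' f p := by
  obtain ⟨W, hW, hpW, hf⟩ := h
  obtain ⟨O, hO, hOo, hpO⟩ := eventually_nhds_iff.1 hfg
  exact ⟨W ∩ O, hW.inter hOo, ⟨hpW, hpO⟩, fun k =>
    ((hf k).mono k inter_subset_left).congr k (hW.inter hOo) fun x hx => hO x hx.2⟩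

theorem IsSmoothAt.comp [IsTopologicalAddGroup F] [ContinuousSMul 𝕜 F] [T2Space F]
    [T2Space H] (hH : IsLocallyConvexTVS 𝕜 H) {g : N → P}
    (hp : p ∈ e.source) (hfp : f p ∈ e'.source) (hfc : ContinuousAt f p)
    (hg : IsSmoothAt 𝕜 e' e'' g (f p)) (hf : IsSmoothAt 𝕜 e e' f p) :
    IsSmoothAt 𝕜 e e'' (fun x => g (f x)) p := by
  have := hH.topologicalAddGroup
  have := hH.continuousSMul
  obtain ⟨V, hV, hpV, hg⟩ := hg
  obtain ⟨W, hW, hpW, hf⟩ := hf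
  have hpre : IsOpen (W ∩ (e' ∘ f ∘ e.symm) ⁻¹' V) := (hf 0).continuousOn.isOpen_inter_preimage hW hV
  refine IsSmoothAt.of_eventuallyEq (φ := fun x => (e'' ∘ g ∘ e'.symm) ((e' ∘ f ∘ e.symm) x))
    ⟨_, hpre, ⟨hpW, by simpa [hp] using hpV⟩, fun k => IsCkOn.comp k hH hV hpre (hg k)
      ((hf k).mono k inter_subset_left) fun x hx => hx.2⟩ ?_
  filter_upwards [e.eventually_symm_nhds hp (hfc.eventually (e'.open_source.mem_nhds hfp))] with x hx
  have hx : f (e.symm x) ∈ e'.source := hx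
  simp [hx]

theorem IsSmoothAt.prodMk [T2Space F] [T2Space H] {g : M → P}
    (hf : IsSmoothAt 𝕜 e e' f p) (hg : IsSmoothAt 𝕜 e e'' g p) :
    IsSmoothAt 𝕜 e (e'.prod e'') (fun x => (f x, g x)) p := by
  obtain ⟨V, hV, hpV, hf⟩ := hf
  obtain ⟨W, hW, hpW, hg⟩ := hg
  exact ⟨V ∩ W, hV.inter hW, ⟨hpV, hpW⟩, fun k => IsCkOn.prodMk k (hV.inter hW)
    ((hf k).mono k inter_subset_left) ((hg k).mono k inter_subset_right)⟩

theorem isSmoothAt_const [T2Space F] (c : N) : IsSmoothAt 𝕜 e e' (fun _ => c) p :=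
  ⟨univ, isOpen_univ, mem_univ _, fun k => isCkOn_const k (e' c)⟩

theorem isSmoothAt_fst [T2Space E] [IsTopologicalAddGroup F] [ContinuousSMul 𝕜 F]
    {q : M × N} (hp : q.1 ∈ e.source) (hq : q.2 ∈ e'.source) :
    IsSmoothAt 𝕜 (e.prod e') e Prod.fst q := by
  refine IsSmoothAt.of_eventuallyEq (φ := ContinuousLinearMap.fst 𝕜 E F)
    ⟨univ, isOpen_univ, mem_univ _, fun k => ContinuousLinearMap.isCkOn k _ _⟩ ?_
  filter_upwards [((e.prod e').open_target).mem_nhds ((e.prod e').map_source ⟨hp, hq⟩)] with x hx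
  exact e.right_inv hx.1

theorem isSmoothAt_snd [T2Space F] [IsTopologicalAddGroup F] [ContinuousSMul 𝕜 F]
    {q : M × N} (hp : q.1 ∈ e.source) (hq : q.2 ∈ e'.source) :
    IsSmoothAt 𝕜 (e.prod e') e' Prod.snd q := by
  refine IsSmoothAt.of_eventuallyEq (φ := ContinuousLinearMap.snd 𝕜 E F)
    ⟨univ, isOpen_univ, mem_univ _, fun k => ContinuousLinearMap.isCkOn k _ _⟩ ?_
  filter_upwards [((e.prod e').open_target).mem_nhds ((e.prod e').map_source ⟨hp, hq⟩)] with x hx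
  exact e'.right_inv hx.2

theorem IsCInftyInCharts.isSmoothAt [T2Space F] (hF : IsLocallyConvexTVS 𝕜 F) (hf : Continuous f)
    (h : IsCInftyInCharts 𝕜 e e' f) (hp : p ∈ e.source) (hfp : f p ∈ e'.source) :
    IsSmoothAt 𝕜 e e' f p :=
  ⟨_, isOpen_chart_domain hf e e', ⟨e.map_source hp, by simpa [hp] using hfp⟩,
    fun k => h.isCkOn hF (isOpen_chart_domain hf e e') k⟩

theorem isCInftyInCharts_of_isSmoothAt [T2Space F] (hf : Continuous f)
    (h : ∀ p ∈ e.source, f p ∈ e'.source → IsSmoothAt 𝕜 e e' f p) :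
    IsCInftyInCharts 𝕜 e e' f := by
  refine isCInftyOn_of_isCkOn (isOpen_chart_domain hf e e') fun k => IsCkOn.of_locally k ?_
  intro x hx
  obtain ⟨W, hW, hxW, hk⟩ := h _ (e.map_target hx.1) hx.2
  rw [e.right_inv hx.1] at hxW
  exact ⟨W, hW, hxW, hk k⟩

end SmoothAt

/-! ### Independence of the chart in the maximal atlas -/

section Manifold

variable {𝕜 : Type*} [RCLike 𝕜]
  {E : Type u} [AddCommGroup E] [Module 𝕜 E] [TopologicalSpace E]
  {F : Type v} [AddCommGroup F] [Module 𝕜 F] [TopologicalSpace F]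
  {M N : Type*} [TopologicalSpace M] [TopologicalSpace N] [ChartedSpace E M] [ChartedSpace F N]

theorem IsCInftyManifold.isCInftyChart (hM : IsCInftyManifold 𝕜 E M)
    {e : OpenPartialHomeomorph M E} (he : e ∈ atlas E M) : IsCInftyChart 𝕜 e :=
  fun _ ha => ⟨hM.transition _ ha _ he, hM.transition _ he _ ha⟩

theorem IsCInftyChart.isSmoothAt_id (hM : IsCInftyManifold 𝕜 E M)
    {φ φ' : OpenPartialHomeomorph M E} (hφ : IsCInftyChart 𝕜 φ) (hφ' : IsCInftyChart 𝕜 φ') {p : M}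
    (hp : p ∈ φ.source) (hp' : p ∈ φ'.source) : IsSmoothAt 𝕜 φ φ' (fun x => x) p := by
  have := hM.model_locallyConvex.topologicalAddGroup
  have := hM.model_locallyConvex.continuousSMul
  have := hM.model_t2
  have ha := mem_chart_source E p
  exact IsSmoothAt.comp (f := fun x => x) (g := fun x => x) hM.model_locallyConvex hp ha
    continuousAt_id
    ((hφ' _ (chart_mem_atlas E p)).1.isSmoothAt hM.model_locallyConvex continuous_id ha hp')
    ((hφ _ (chart_mem_atlas E p)).2.isSmoothAt hM.model_locallyConvex continuous_id hp ha)

theorem IsCInftyMap.isSmoothAt (hM : IsCInftyManifold 𝕜 E M) (hN : IsCInftyManifold 𝕜 F N)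
    {f : M → N} (hf : IsCInftyMap 𝕜 E F f)
    {φ : OpenPartialHomeomorph M E} {ψ : OpenPartialHomeomorph N F}
    (hφ : IsCInftyChart 𝕜 φ) (hψ : IsCInftyChart 𝕜 ψ) {p : M}
    (hp : p ∈ φ.source) (hp' : f p ∈ ψ.source) : IsSmoothAt 𝕜 φ ψ f p := by
  have := hM.model_locallyConvex.topologicalAddGroup
  have := hM.model_locallyConvex.continuousSMul
  have := hM.model_t2
  have := hN.model_locallyConvex.topologicalAddGroup
  have := hN.model_locallyConvex.continuousSMul
  have := hN.model_t2
  have ha := chart_mem_atlas E p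
  have hb := chart_mem_atlas F (f p)
  refine IsSmoothAt.comp (f := f) (g := fun x => x) hN.model_locallyConvex hp
    (mem_chart_source F (f p)) hf.1.continuousAt
    (IsCInftyChart.isSmoothAt_id hN (hN.isCInftyChart hb) hψ (mem_chart_source F _) hp') ?_
  exact IsSmoothAt.comp (f := fun x => x) (g := f) hN.model_locallyConvex hp
    (mem_chart_source E p) continuousAt_id
    ((hf.2 _ ha _ hb).isSmoothAt hN.model_locallyConvex hf.1 (mem_chart_source E p)
      (mem_chart_source F _))
    (IsCInftyChart.isSmoothAt_id hM hφ (hM.isCInftyChart ha) hp (mem_chart_source E p))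

end Manifold

/-! ### Lie group operations in arbitrary charts -/

section LieGroup

variable {𝕜 : Type*} [RCLike 𝕜]
  {E : Type u} [AddCommGroup E] [Module 𝕜 E] [TopologicalSpace E]
  {G : Type*} [Group G] [TopologicalSpace G] [ChartedSpace E G]

theorem IsCInftyLieGroup.isTopologicalGroup (hG : IsCInftyLieGroup 𝕜 E G) :
    IsTopologicalGroup G :=
  { continuous_mul := hG.continuous_mul
    continuous_inv := hG.inv.1 }

/-- `mul_charts` speaks of the given atlas only; changes of charts on both factors and on the target
extend it to the maximal atlas. -/
theorem IsCInftyLieGroup.isSmoothAt_mul (hG : IsCInftyLieGroup 𝕜 E G)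
    {φ₁ φ₂ φ₃ : OpenPartialHomeomorph G E} (h₁ : IsCInftyChart 𝕜 φ₁) (h₂ : IsCInftyChart 𝕜 φ₂)
    (h₃ : IsCInftyChart 𝕜 φ₃) {p q : G} (hp : p ∈ φ₁.source) (hq : q ∈ φ₂.source)
    (hpq : p * q ∈ φ₃.source) :
    IsSmoothAt 𝕜 (φ₁.prod φ₂) φ₃ (fun x : G × G => x.1 * x.2) (p, q) := by
  have hM := hG.manifold
  have hE := hM.model_locallyConvex
  have := hE.topologicalAddGroup
  have := hE.continuousSMul
  have := hM.model_t2
  have ha := chart_mem_atlas E p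
  have hb := chart_mem_atlas E q
  have hc := chart_mem_atlas E (p * q)
  have hac := hM.isCInftyChart ha
  have hbc := hM.isCInftyChart hb
  have hcc := hM.isCInftyChart hc
  have hs : (p, q) ∈ (φ₁.prod φ₂).source := ⟨hp, hq⟩
  have hs' : (p, q) ∈ ((chartAt E p).prod (chartAt E q)).source :=
    ⟨mem_chart_source E p, mem_chart_source E q⟩
  have hid : IsSmoothAt 𝕜 (φ₁.prod φ₂) ((chartAt E p).prod (chartAt E q))
      (fun x : G × G => (x.1, x.2)) (p, q) := by
    refine IsSmoothAt.prodMk ?_ ?_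
    · exact IsSmoothAt.comp (f := Prod.fst) (g := fun x => x) hE hs hp continuousAt_fst
        (IsCInftyChart.isSmoothAt_id hM h₁ hac hp (mem_chart_source E p)) (isSmoothAt_fst hp hq)
    · exact IsSmoothAt.comp (f := Prod.snd) (g := fun x => x) hE hs hq continuousAt_snd
        (IsCInftyChart.isSmoothAt_id hM h₂ hbc hq (mem_chart_source E q)) (isSmoothAt_snd hp hq)
  refine IsSmoothAt.comp (g := fun x => x) hE hs (mem_chart_source E (p * q))
    hG.continuous_mul.continuousAt
    (IsCInftyChart.isSmoothAt_id hM hcc h₃ (mem_chart_source E _) hpq) ?_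
  exact IsSmoothAt.comp (f := fun x : G × G => (x.1, x.2)) (g := fun x : G × G => x.1 * x.2) hE hs
    hs' continuousAt_id ((hG.mul_charts _ ha _ hb _ hc).isSmoothAt hE hG.continuous_mul hs'
      (mem_chart_source E _)) hid

theorem IsCInftyLieGroup.isSmoothAt_mul_left (hG : IsCInftyLieGroup 𝕜 E G)
    {φ φ' : OpenPartialHomeomorph G E} (h : IsCInftyChart 𝕜 φ) (h' : IsCInftyChart 𝕜 φ')
    (g : G) {p : G} (hp : p ∈ φ.source) (hgp : g * p ∈ φ'.source) :
    IsSmoothAt 𝕜 φ φ' (fun x : G => g * x) p := by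
  have hM := hG.manifold
  have hE := hM.model_locallyConvex
  have := hE.topologicalAddGroup
  have := hE.continuousSMul
  have := hM.model_t2
  have hg := hM.isCInftyChart (chart_mem_atlas E g)
  exact IsSmoothAt.comp (e' := (chartAt E g).prod φ) (f := fun x : G => (g, x))
    (g := fun x : G × G => x.1 * x.2) hE hp
    ⟨mem_chart_source E g, hp⟩ (by fun_prop)
    (hG.isSmoothAt_mul hg h h' (mem_chart_source E g) hp hgp)
    ((isSmoothAt_const g).prodMk (IsCInftyChart.isSmoothAt_id hM h h hp hp))

theorem IsCInftyLieGroup.isSmoothAt_inv_mul (hG : IsCInftyLieGroup 𝕜 E G)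
    {φ₁ φ₂ φ₃ : OpenPartialHomeomorph G E} (h₁ : IsCInftyChart 𝕜 φ₁) (h₂ : IsCInftyChart 𝕜 φ₂)
    (h₃ : IsCInftyChart 𝕜 φ₃) {p q : G} (hp : p ∈ φ₁.source) (hq : q ∈ φ₂.source)
    (hpq : p⁻¹ * q ∈ φ₃.source) :
    IsSmoothAt 𝕜 (φ₁.prod φ₂) φ₃ (fun x : G × G => x.1⁻¹ * x.2) (p, q) := by
  have hM := hG.manifold
  have hE := hM.model_locallyConvex
  have := hE.topologicalAddGroup
  have := hE.continuousSMul
  have := hM.model_t2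
  have := hG.isTopologicalGroup
  have hi := hM.isCInftyChart (chart_mem_atlas E p⁻¹)
  have hs : (p, q) ∈ (φ₁.prod φ₂).source := ⟨hp, hq⟩
  refine IsSmoothAt.comp (e' := (chartAt E p⁻¹).prod φ₂) (f := fun x : G × G => (x.1⁻¹, x.2))
    (g := fun x : G × G => x.1 * x.2) hE hs
    ⟨mem_chart_source E p⁻¹, hq⟩ (by fun_prop)
    (hG.isSmoothAt_mul hi h₂ h₃ (mem_chart_source E p⁻¹) hq hpq) (IsSmoothAt.prodMk ?_
      (isSmoothAt_snd hp hq))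
  exact IsSmoothAt.comp (f := Prod.fst) (g := fun x : G => x⁻¹) hE hs hp continuousAt_fst
    (hG.inv.isSmoothAt hM hM h₁ hi hp (mem_chart_source E _)) (isSmoothAt_fst hp hq)

end LieGroup

/-! ### Continuity of linear maps on a locally convex direct limit -/

section LinearDirectLimit

theorem isLocallyConvexTVS_induced {𝕜 : Type*} [RCLike 𝕜] {E F : Type*} [AddCommGroup E]
    [Module 𝕜 E] [AddCommGroup F] [Module 𝕜 F] [τ : TopologicalSpace F]
    (hF : IsLocallyConvexTVS 𝕜 F) (L : E →ₗ[𝕜] F) :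
    @IsLocallyConvexTVS 𝕜 _ E _ _ (τ.induced L) := by
  have := hF.topologicalAddGroup
  have := hF.continuousSMul
  refine @IsLocallyConvexTVS.mk 𝕜 _ E _ _ (τ.induced L) (topologicalAddGroup_induced L)
    (continuousSMul_induced L) ?_
  let _ : Module ℝ F := Module.compHom F (algebraMap ℝ 𝕜)
  let _ : Module ℝ E := Module.compHom E (algebraMap ℝ 𝕜)
  have : LocallyConvexSpace ℝ F := hF.locallyConvex
  exact LocallyConvexSpace.induced ({ L with map_smul' := fun c x => L.map_smul _ x } : E →ₗ[ℝ] F)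

variable {𝕜 : Type*} [RCLike 𝕜] {E : Type u} [AddCommGroup E] [Module 𝕜 E] [TopologicalSpace E]
  {En : ℕ → Type*} [∀ n, AddCommGroup (En n)] [∀ n, Module 𝕜 (En n)]
  [∀ n, TopologicalSpace (En n)] {n₀ : ℕ} {jj : ∀ m n, En m →L[𝕜] En n} {j : ∀ n, En n →L[𝕜] E}

/-- The continuous map given by the universal property agrees with `e` on the images of the `En n`,
which cover `E`. The target must lie in the universe of `E`. -/
theorem IsDirectLimitLCS.continuous_equiv (h : IsDirectLimitLCS 𝕜 n₀ jj j)
    (hj : (⋃ n ≥ n₀, range (j n)) = univ) {E' : Type u} [AddCommGroup E'] [Module 𝕜 E']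
    [TopologicalSpace E'] (hE' : IsLocallyConvexTVS 𝕜 E') (e : E →ₗ[𝕜] E')
    (he : ∀ n ≥ n₀, Continuous fun y => e (j n y)) : Continuous e := by
  classical
  let f : ∀ n, En n →L[𝕜] E' := fun n =>
    if hn : n₀ ≤ n then ⟨e ∘ₗ (j n).toLinearMap, he n hn⟩ else 0
  have hf : ∀ n, n₀ ≤ n → ∀ y, f n y = e (j n y) := fun n hn y => by simp [f, hn]
  obtain ⟨θ, hθ, -⟩ := h.desc E' hE' f fun m n hm hmn y => by
    rw [hf m hm, hf n (hm.trans hmn), h.cone m n hm hmn]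
  have : (θ : E → E') = e := by
    funext x
    obtain ⟨n, hn, y, rfl⟩ : ∃ n, n₀ ≤ n ∧ x ∈ range (j n) := by
      simpa using (Set.ext_iff.1 hj x).2 (mem_univ x)
    rw [hθ n hn, hf n hn]
  exact this ▸ θ.continuous

/-- A linear map on a direct limit is continuous if its restrictions are; the target may live in
any universe. -/
theorem IsDirectLimitLCS.continuous_of_restrict (h : IsDirectLimitLCS 𝕜 n₀ jj j)
    (hj : (⋃ n ≥ n₀, range (j n)) = univ) {F : Type*} [AddCommGroup F] [Module 𝕜 F]
    [τ : TopologicalSpace F] (hF : IsLocallyConvexTVS 𝕜 F) (L : E →ₗ[𝕜] F)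
    (hL : ∀ n ≥ n₀, Continuous fun y => L (j n y)) : Continuous L := by
  -- The test space is `E` with the topology induced by `L`; this avoids the universe of `F`.
  have := @IsDirectLimitLCS.continuous_equiv 𝕜 _ E _ _ _ En _ _ _ n₀ jj j h hj E _ _
    (τ.induced L) (isLocallyConvexTVS_induced hF L) LinearMap.id
    fun n hn => continuous_induced_rng.2 (hL n hn)
  exact continuous_induced_rng.1 this

end LinearDirectLimit

/-! ### Differentials and continuous linear maps -/

section Calculus

variable {𝕜 : Type*} [RCLike 𝕜]

theorem dirDeriv_comp_continuousLinearMap {E E' F : Type*} [AddCommGroup E] [Module 𝕜 E]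
    [TopologicalSpace E] [AddCommGroup E'] [Module 𝕜 E'] [TopologicalSpace E'] [AddCommGroup F]
    [Module 𝕜 F] [TopologicalSpace F] (f : E' → F) (l : E →L[𝕜] E') (x y : E) :
    dirDeriv 𝕜 (fun z => f (l z)) (x, y) = dirDeriv 𝕜 f (l x, l y) := by
  simp [dirDeriv]

theorem hasDirectionalDeriv_comp_continuousLinearMap {E E' F : Type*} [AddCommGroup E] [Module 𝕜 E]
    [TopologicalSpace E] [AddCommGroup E'] [Module 𝕜 E'] [TopologicalSpace E'] [AddCommGroup F]
    [Module 𝕜 F] [TopologicalSpace F] {f : E' → F} {l : E →L[𝕜] E'} {x y : E} {a : F} :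
    HasDirectionalDeriv 𝕜 (fun z => f (l z)) a x y ↔ HasDirectionalDeriv 𝕜 f a (l x) (l y) := by
  simp [HasDirectionalDeriv]

theorem HasDirectionalDeriv.continuousLinearMap_comp {E F F' : Type*} [AddCommGroup E] [Module 𝕜 E]
    [AddCommGroup F] [Module 𝕜 F] [TopologicalSpace F] [AddCommGroup F'] [Module 𝕜 F']
    [TopologicalSpace F'] {f : E → F} {x y : E} {a : F} (h : HasDirectionalDeriv 𝕜 f a x y)
    (l : F →L[𝕜] F') : HasDirectionalDeriv 𝕜 (fun z => l (f z)) (l a) x y :=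
  ((l.continuous.tendsto _).comp h).congr fun t => by simp

variable {E : Type u} [AddCommGroup E] [Module 𝕜 E] [TopologicalSpace E]
  {F : Type v} [AddCommGroup F] [Module 𝕜 F] [TopologicalSpace F]
  {M N : Type*} [TopologicalSpace M] [TopologicalSpace N]
  {e : OpenPartialHomeomorph M E} {e' : OpenPartialHomeomorph N F} {f : M → N} {p : M}

theorem IsSmoothAt.hasDirectionalDeriv (h : IsSmoothAt 𝕜 e e' f p) (y : E) :
    HasDirectionalDeriv 𝕜 (e' ∘ f ∘ e.symm) (dirDeriv 𝕜 (e' ∘ f ∘ e.symm) (e p, y)) (e p) y := by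
  obtain ⟨W, -, hp, hk⟩ := h
  exact (hk 1).2.1 _ hp y

theorem IsSmoothAt.exists_differential [IsTopologicalAddGroup E] [ContinuousSMul 𝕜 E] [T2Space F]
    (hF : IsLocallyConvexTVS 𝕜 F) (h : IsSmoothAt 𝕜 e e' f p) :
    ∃ l : E →L[𝕜] F, ∀ y, l y = dirDeriv 𝕜 (e' ∘ f ∘ e.symm) (e p, y) := by
  have := hF.continuousSMul
  obtain ⟨W, hW, hp, hk⟩ := h
  refine ⟨{ toFun := fun y => dirDeriv 𝕜 (e' ∘ f ∘ e.symm) (e p, y)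
            map_add' := differential_add hF hW (hk 1).2.1 (hk 1).2.2 hp
            map_smul' := differential_smul (hk 1).2.1 hp
            cont := ?_ }, fun y => rfl⟩
  have hc : ContinuousOn (dirDeriv 𝕜 (e' ∘ f ∘ e.symm)) (W ×ˢ univ) := (hk 1).2.2
  exact continuousOn_univ.1 (hc.comp (f := fun y => (e p, y)) (by fun_prop)
    fun y _ => ⟨hp, mem_univ _⟩)

end Calculus

/-! ### Left trivialisation and the regularity of homomorphisms -/

section Homomorphisms

variable {𝕜 : Type*} [RCLike 𝕜]
  {E : Type u} [AddCommGroup E] [Module 𝕜 E] [TopologicalSpace E]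
  {F : Type v} [AddCommGroup F] [Module 𝕜 F] [TopologicalSpace F]
  {G : Type*} [Group G] [TopologicalSpace G] [ChartedSpace E G]
  {H : Type*} [Group H] [TopologicalSpace H] [ChartedSpace F H]

/-- In charts, the differential of a homomorphism at any point is determined by its differential
at the identity. -/
theorem dirDeriv_monoidHom (hG : IsCInftyLieGroup 𝕜 E G) (hH : IsCInftyLieGroup 𝕜 F H)
    {φ : OpenPartialHomeomorph G E} {ψ : OpenPartialHomeomorph H F} (hφ : IsCInftyChart 𝕜 φ)
    (hψ : IsCInftyChart 𝕜 ψ) (h1φ : (1 : G) ∈ φ.source) (h1ψ : (1 : H) ∈ ψ.source) {f : G →* H}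
    (hf : Continuous f) (hf1 : IsSmoothAt 𝕜 φ ψ f 1) {p : G} (hp : p ∈ φ.source)
    (hfp : f p ∈ ψ.source) (y : E) :
    dirDeriv 𝕜 (ψ ∘ f ∘ φ.symm) (φ p, y) =
      dirDeriv 𝕜 (ψ ∘ (fun q : H × H => q.1 * q.2) ∘ (ψ.prod ψ).symm) ((ψ (f p), ψ 1),
        (0, dirDeriv 𝕜 (ψ ∘ f ∘ φ.symm)
          (φ 1, dirDeriv 𝕜 (φ ∘ (fun x => p⁻¹ * x) ∘ φ.symm) (φ p, y)))) := by
  have hE := hG.manifold.model_locallyConvex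
  have := hE.topologicalAddGroup
  have := hE.continuousSMul
  have := hG.manifold.model_t2
  have hF := hH.manifold.model_locallyConvex
  have := hF.topologicalAddGroup
  have := hF.continuousSMul
  have := hH.manifold.model_t2
  have := hG.isTopologicalGroup
  have hδ := (hG.isSmoothAt_mul_left hφ hφ p⁻¹ hp (by simpa using h1φ)).hasDirectionalDeriv y
  set δ := φ ∘ (fun x => p⁻¹ * x) ∘ φ.symm with hδ_def
  have hδp : δ (φ p) = φ 1 := by simp [hδ_def, hp]
  obtain ⟨W, hW, h1W, hk⟩ := hf1
  obtain ⟨V, hV, h1V, hm⟩ := hH.isSmoothAt_mul hψ hψ hψ hfp h1ψ (by simpa using hfp)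
  have h₁ := hδ.comp hF hW (hk 1).2.1 (hk 1).2.2.continuousOn (by rwa [hδp])
  have h₂ : HasDirectionalDeriv 𝕜 (fun z => (ψ (f p), (ψ ∘ f ∘ φ.symm) (δ z)))
      (0, dirDeriv 𝕜 (ψ ∘ f ∘ φ.symm) (δ (φ p), dirDeriv 𝕜 δ (φ p, y))) (φ p) y :=
    Tendsto.prodMk_nhds (by simp) h₁
  have hval : (ψ ∘ f ∘ φ.symm) (δ (φ p)) = ψ 1 := by simp [hδp, h1φ]
  have h₃ := h₂.comp hF hV (hm 1).2.1 (hm 1).2.2.continuousOn (by rw [hval]; exact h1V)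
  rw [hval, hδp] at h₃
  -- `h₃` differentiates `f p * f (p⁻¹ * x)` in charts; near `p` this is `f x`.
  refine (h₃.congr ?_).dirDeriv_eq
  have hc : ContinuousAt (fun x => p⁻¹ * x) p := by fun_prop
  have ev₁ : ∀ᶠ x in 𝓝 p, p⁻¹ * x ∈ φ.source :=
    hc.eventually (φ.open_source.mem_nhds (by simpa using h1φ))
  have ev₂ : ∀ᶠ x in 𝓝 p, f (p⁻¹ * x) ∈ ψ.source :=
    (ContinuousAt.comp (f := fun x => p⁻¹ * x) hf.continuousAt hc).eventually
      (ψ.open_source.mem_nhds (by simpa using h1ψ))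
  filter_upwards [φ.eventually_symm_nhds hp ev₁, φ.eventually_symm_nhds hp ev₂] with z hz₁ hz₂
  simp only [hδ_def, Function.comp_apply, OpenPartialHomeomorph.prod_symm,
    OpenPartialHomeomorph.prod_apply, φ.left_inv hz₁, ψ.left_inv hz₂, ψ.left_inv hfp]
  simp

/-- A continuous map between charts of Lie groups whose differential is obtained from a continuous
linear map through left trivialisations is `C^k` for all `k`. -/
theorem isCkOn_of_trivialized_differential (hG : IsCInftyLieGroup 𝕜 E G)
    (hH : IsCInftyLieGroup 𝕜 F H)
    {φ : OpenPartialHomeomorph G E} {ψ : OpenPartialHomeomorph H F} (hφ : IsCInftyChart 𝕜 φ)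
    (hψ : IsCInftyChart 𝕜 ψ) (h1φ : (1 : G) ∈ φ.source) (h1ψ : (1 : H) ∈ ψ.source)
    {f : E → F} {U : Set E} (hU : IsOpen U) (hUφ : U ⊆ φ.target) (hfc : ContinuousOn f U)
    (hfψ : MapsTo f U ψ.target) (L : E →L[𝕜] F)
    (hd : ∀ x ∈ U, ∀ y, HasDirectionalDeriv 𝕜 f
      (dirDeriv 𝕜 (ψ ∘ (fun q : H × H => q.1 * q.2) ∘ (ψ.prod ψ).symm) ((f x, ψ 1),
        (0, L (dirDeriv 𝕜 (φ ∘ (fun q : G × G => q.1⁻¹ * q.2) ∘ (φ.prod φ).symm)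
          ((x, x), (0, y)))))) x y) (k : ℕ) : IsCkOn 𝕜 k f U := by
  have hE := hG.manifold.model_locallyConvex
  have := hE.topologicalAddGroup
  have := hE.continuousSMul
  have := hG.manifold.model_t2
  have hF := hH.manifold.model_locallyConvex
  have := hF.topologicalAddGroup
  have := hF.continuousSMul
  have := hH.manifold.model_t2
  -- The left trivialisation of `G`: the derivative of `q.1⁻¹ * q.2` in its second variable on the
  -- diagonal. The first variable is kept so that smoothness in the base point is visible.
  have hA : ∀ k, IsCkOn 𝕜 k (fun p : E × E => dirDeriv 𝕜
      (φ ∘ (fun q : G × G => q.1⁻¹ * q.2) ∘ (φ.prod φ).symm) ((p.1, p.1), (0, p.2)))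
      (U ×ˢ univ) := by
    intro k
    refine IsCkOn.of_locally k fun p hp => ?_
    have hs := φ.map_target (hUφ hp.1)
    obtain ⟨W, hW, hpW, hk⟩ := hG.isSmoothAt_inv_mul hφ hφ hφ hs hs (by simpa using h1φ)
    let l : E × E →L[𝕜] (E × E) × (E × E) :=
      { toFun := fun p => ((p.1, p.1), (0, p.2))
        map_add' := fun p q => by simp
        map_smul' := fun c q => by simp
        cont := by fun_prop }
    have hWo : IsOpen ((fun x : E => (x, x)) ⁻¹' W) := hW.preimage (by fun_prop)
    refine ⟨((fun x : E => (x, x)) ⁻¹' W) ×ˢ univ, hWo.prod isOpen_univ, ⟨?_, mem_univ _⟩,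
      IsCkOn.comp_continuousLinearMap k (hWo.prod isOpen_univ) (hk (k + 1)).2.2 l
        fun q hq => ⟨hq.1, mem_univ _⟩⟩
    simpa [φ.right_inv (hUφ hp.1)] using hpW
  have hB : ∀ k, IsCkOn 𝕜 k (fun p : F × F => dirDeriv 𝕜
      (ψ ∘ (fun q : H × H => q.1 * q.2) ∘ (ψ.prod ψ).symm) ((p.1, ψ 1), (0, p.2)))
      (ψ.target ×ˢ univ) := by
    intro k
    refine IsCkOn.of_locally k fun p hp => ?_
    have hs := ψ.map_target hp.1
    obtain ⟨W, hW, hpW, hk⟩ := hH.isSmoothAt_mul hψ hψ hψ hs h1ψ (by simpa using hs)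
    have hWo : IsOpen ((fun x : F => (x, ψ 1)) ⁻¹' W) := hW.preimage (by fun_prop)
    have hO : IsOpen (((fun x : F => (x, ψ 1)) ⁻¹' W) ×ˢ (univ : Set F)) := hWo.prod isOpen_univ
    refine ⟨((fun x : F => (x, ψ 1)) ⁻¹' W) ×ˢ univ, hO, ⟨?_, mem_univ _⟩,
      IsCkOn.comp k hF (hW.prod isOpen_univ) hO (hk (k + 1)).2.2
        (IsCkOn.prodMk k hO (IsCkOn.prodMk k hO
          (ContinuousLinearMap.isCkOn k (ContinuousLinearMap.fst 𝕜 F F) _)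
          ((isCkOn_const k (ψ 1)).mono k (subset_univ _)))
          (ContinuousLinearMap.isCkOn k
            ((ContinuousLinearMap.inr 𝕜 F F).comp (ContinuousLinearMap.snd 𝕜 F F)) _))
        fun q hq => ⟨hq.1, mem_univ _⟩⟩
    simpa [ψ.right_inv hp.1] using hpW
  have hO : IsOpen (U ×ˢ (univ : Set E)) := hU.prod isOpen_univ
  -- Bootstrapping: the given differential involves `f` only through its values, so it is as regular
  -- as `f`.
  induction k with
  | zero => exact hfc
  | succ k ih =>
    refine IsCkOn.of_hasDirectionalDeriv (df := fun p : E × E =>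
      dirDeriv 𝕜 (ψ ∘ (fun q : H × H => q.1 * q.2) ∘ (ψ.prod ψ).symm) ((f p.1, ψ 1),
        (0, L (dirDeriv 𝕜 (φ ∘ (fun q : G × G => q.1⁻¹ * q.2) ∘ (φ.prod φ).symm)
          ((p.1, p.1), (0, p.2)))))) hU hfc hd ?_
    exact IsCkOn.comp k (g := fun p : E × E => (f p.1, L (dirDeriv 𝕜
        (φ ∘ (fun q : G × G => q.1⁻¹ * q.2) ∘ (φ.prod φ).symm) ((p.1, p.1), (0, p.2)))))
      hF (ψ.open_target.prod isOpen_univ) hO (hB k)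
      (IsCkOn.prodMk k hO
        (IsCkOn.comp_continuousLinearMap k hO ih (ContinuousLinearMap.fst 𝕜 E E) fun p hp => hp.1)
        (IsCkOn.comp k hF isOpen_univ hO (ContinuousLinearMap.isCkOn k L univ) (hA k)
          fun _ _ => mem_univ _))
      fun p hp => ⟨hfψ hp.1, mem_univ _⟩

/-- A continuous homomorphism between Lie groups which is smooth at the identity is smooth. -/
theorem isCInftyMap_of_isSmoothAt_one (hG : IsCInftyLieGroup 𝕜 E G) (hH : IsCInftyLieGroup 𝕜 F H)
    {φ : OpenPartialHomeomorph G E} {ψ : OpenPartialHomeomorph H F} (hφ : IsCInftyChart 𝕜 φ)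
    (hψ : IsCInftyChart 𝕜 ψ) (h1φ : (1 : G) ∈ φ.source) (h1ψ : (1 : H) ∈ ψ.source) {f : G →* H}
    (hf : Continuous f) (hf1 : IsSmoothAt 𝕜 φ ψ f 1) : IsCInftyMap 𝕜 E F f := by
  have hE := hG.manifold.model_locallyConvex
  have := hE.topologicalAddGroup
  have := hE.continuousSMul
  have := hG.manifold.model_t2
  have hF := hH.manifold.model_locallyConvex
  have := hF.topologicalAddGroup
  have := hF.continuousSMul
  have := hH.manifold.model_t2
  have := hG.isTopologicalGroup
  refine ⟨hf, fun e he e' he' => isCInftyInCharts_of_isSmoothAt hf fun p hp hfp => ?_⟩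
  -- Again `f x = f p * f (p⁻¹ * x)`, which moves the question from `p` to `1`.
  have hl := hG.isSmoothAt_mul_left (hG.manifold.isCInftyChart he) hφ p⁻¹ hp (by simpa using h1φ)
  have hr := hH.isSmoothAt_mul_left hψ (hH.manifold.isCInftyChart he') (f p) h1ψ
    (by simpa using hfp)
  have h₁ : IsSmoothAt 𝕜 e ψ (fun x => f (p⁻¹ * x)) p :=
    IsSmoothAt.comp (f := fun x => p⁻¹ * x) (g := f) hF hp (by simpa using h1φ) (by fun_prop)
      (by simpa using hf1) hl
  have h₂ : IsSmoothAt 𝕜 e e' (fun x => f p * f (p⁻¹ * x)) p :=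
    IsSmoothAt.comp (f := fun x => f (p⁻¹ * x)) (g := fun x => f p * x) hF hp
      (by simpa using h1ψ) (by fun_prop) (by simpa using hr) h₁
  simpa using h₂

end Homomorphisms

/-! ### Homomorphisms on the union and their continuity -/

section AscendingUnion

variable {G : Type u} [Group G] {Gn : ℕ → Type*} [∀ n, Group (Gn n)]
  {ι : ∀ {m n : ℕ}, m ≤ n → (Gn m →* Gn n)} {i : ∀ n, Gn n →* G}
  {H : Type v} [Group H]

theorem exists_monoidHom_of_ascending_union (hinj : ∀ n, Function.Injective (i n))
    (hcomp : ∀ {m n : ℕ} (h : m ≤ n) (g : Gn m), i n (ι h g) = i m g)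
    (hunion : ⋃ n, range (i n) = univ) (f : ∀ n, Gn n →* H)
    (hf : ∀ {m n : ℕ} (h : m ≤ n) (g : Gn m), f n (ι h g) = f m g) :
    ∃ F : G →* H, ∀ n g, F (i n g) = f n g := by
  have hsurj : ∀ x : G, ∃ n, ∃ g : Gn n, i n g = x := fun x => by
    simpa using (Set.ext_iff.1 hunion x).2 (mem_univ x)
  -- Two representatives of one element become equal at level `max m n`, because `i` is injective
  -- there.
  have hwd : ∀ m n (a : Gn m) (b : Gn n), i m a = i n b → f m a = f n b := by
    intro m n a b hab
    rw [← hf (le_max_left m n) a, ← hf (le_max_right m n) b]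
    congr 1
    apply hinj
    rw [hcomp, hcomp, hab]
  choose n g hg using hsurj
  have hF : ∀ m (a : Gn m), f (n (i m a)) (g (i m a)) = f m a := fun m a => hwd _ _ _ _ (hg _)
  refine ⟨MonoidHom.mk' (fun x => f (n x) (g x)) fun x y => ?_, hF⟩
  have hx : x = i (max (n x) (n y)) (ι (le_max_left _ _) (g x)) := by rw [hcomp, hg]
  have hy : y = i (max (n x) (n y)) (ι (le_max_right _ _) (g y)) := by rw [hcomp, hg]
  have hxy : x * y = i (max (n x) (n y)) (ι (le_max_left _ _) (g x) * ι (le_max_right _ _) (g y)) := by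
    rw [map_mul, ← hx, ← hy]
  calc f (n (x * y)) (g (x * y))
      = f (max (n x) (n y)) (ι (le_max_left _ _) (g x) * ι (le_max_right _ _) (g y)) :=
        hwd _ _ _ _ (by rw [hg]; exact hxy)
    _ = f (n x) (g x) * f (n y) (g y) := by rw [map_mul, hf, hf]

/-- A homomorphism on a direct limit of topological groups is continuous if its restrictions are;
the target may live in any universe. -/
theorem IsDirectLimitTopGroup.continuous_of_restrict [TopologicalSpace G]
    [∀ n, TopologicalSpace (Gn n)] (h : IsDirectLimitTopGroup ι i)
    (hunion : ⋃ n, range (i n) = univ) [τ : TopologicalSpace H] [IsTopologicalGroup H]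
    (F : G →* H) (hF : ∀ n, Continuous fun g => F (i n g)) : Continuous F := by
  -- The test group is `G` with the topology induced by `F`. The resulting homomorphism is the
  -- identity, whose continuity into this topology is that of `F`.
  obtain ⟨F', ⟨hc, hF'⟩, -⟩ := @IsDirectLimitTopGroup.desc G _ _ Gn _ _ ι i h G _ (τ.induced F)
    (topologicalGroup_induced F) i (fun n => continuous_induced_rng.2 (hF n)) h.cone
  have : (F' : G → G) = id := by
    funext x
    obtain ⟨n, g, rfl⟩ : ∃ n, ∃ g : Gn n, i n g = x := by
      simpa using (Set.ext_iff.1 hunion x).2 (mem_univ x)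
    exact hF' n g
  rw [this] at hc
  exact continuous_induced_rng.1 hc

end AscendingUnion

/-! ### Charts in which an inclusion becomes a linear map -/

section CompatibleCharts

variable {𝕜 : Type*} [RCLike 𝕜]
  {E : Type u} [AddCommGroup E] [Module 𝕜 E] [TopologicalSpace E]
  {E' : Type v} [AddCommGroup E'] [Module 𝕜 E'] [TopologicalSpace E']
  {G K : Type*} [TopologicalSpace G] [TopologicalSpace K]
  {φ : OpenPartialHomeomorph G E} {φ' : OpenPartialHomeomorph K E'} {l : E' →L[𝕜] E}

theorem symm_apply_of_compatible {i : K → G}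
    (h : ∀ g ∈ φ'.source, i g ∈ φ.source ∧ φ (i g) = l (φ' g)) {z : E'} (hz : z ∈ φ'.target) :
    φ.symm (l z) = i (φ'.symm z) := by
  obtain ⟨h₁, h₂⟩ := h _ (φ'.map_target hz)
  rw [φ'.right_inv hz] at h₂
  rw [← h₂, φ.left_inv h₁]

theorem eventuallyEq_of_compatible {H F : Type*} {i : K → G}
    (h : ∀ g ∈ φ'.source, i g ∈ φ.source ∧ φ (i g) = l (φ' g)) {f : G → H} {f' : K → H}
    (hf : ∀ g, f (i g) = f' g) (ψ : H → F) {p : K} (hp : p ∈ φ'.source) :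
    (ψ ∘ f' ∘ φ'.symm) =ᶠ[𝓝 (φ' p)] fun z => (ψ ∘ f ∘ φ.symm) (l z) := by
  filter_upwards [φ'.open_target.mem_nhds (φ'.map_source hp)] with z hz
  simp [symm_apply_of_compatible h hz, hf]

theorem dirDeriv_of_compatible [IsTopologicalAddGroup E'] [ContinuousSMul 𝕜 E']
    {H F : Type*} [AddCommGroup F] [Module 𝕜 F] [TopologicalSpace F] {i : K → G}
    (h : ∀ g ∈ φ'.source, i g ∈ φ.source ∧ φ (i g) = l (φ' g)) {f : G → H} {f' : K → H}
    (hf : ∀ g, f (i g) = f' g) (ψ : H → F) {p : K} (hp : p ∈ φ'.source) (y : E') :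
    dirDeriv 𝕜 (ψ ∘ f ∘ φ.symm) (l (φ' p), l y) = dirDeriv 𝕜 (ψ ∘ f' ∘ φ'.symm) (φ' p, y) := by
  rw [dirDeriv_congr (eventuallyEq_of_compatible h hf ψ hp), dirDeriv_comp_continuousLinearMap]

variable [Group G] [Group K] [ChartedSpace E' K]

/-- Along the image of `K`, left translation in the chart `φ` is `l` applied to left translation in
`φ'`, and a continuous linear map commutes with the limit of difference quotients. -/
theorem dirDeriv_mul_left_of_compatible [T2Space E] (hK : IsCInftyLieGroup 𝕜 E' K)
    (hφ' : IsCInftyChart 𝕜 φ') (h1 : (1 : K) ∈ φ'.source) {i : K →* G}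
    (h : ∀ g ∈ φ'.source, i g ∈ φ.source ∧ φ (i g) = l (φ' g)) {p : K} (hp : p ∈ φ'.source)
    (y : E') :
    dirDeriv 𝕜 (φ ∘ (fun x => (i p)⁻¹ * x) ∘ φ.symm) (l (φ' p), l y) =
      l (dirDeriv 𝕜 (φ' ∘ (fun x => p⁻¹ * x) ∘ φ'.symm) (φ' p, y)) := by
  have hE := hK.manifold.model_locallyConvex
  have := hE.topologicalAddGroup
  have := hE.continuousSMul
  have := hK.isTopologicalGroup
  have hd := ((hK.isSmoothAt_mul_left hφ' hφ' p⁻¹ hp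
    (by simpa using h1)).hasDirectionalDeriv y).continuousLinearMap_comp l
  refine (hasDirectionalDeriv_comp_continuousLinearMap.1 (hd.congr ?_)).dirDeriv_eq
  have hc : ContinuousAt (fun x => p⁻¹ * x) p := by fun_prop
  have ev : ∀ᶠ x in 𝓝 p, p⁻¹ * x ∈ φ'.source :=
    hc.eventually (φ'.open_source.mem_nhds (by simpa using h1))
  filter_upwards [φ'.eventually_symm_nhds hp ev,
    φ'.open_target.mem_nhds (φ'.map_source hp)] with z hz₁ hz₂
  have := (h _ hz₁).2
  rw [map_mul, map_inv] at this
  simp [symm_apply_of_compatible h hz₂, this]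

end CompatibleCharts

/-! ### Smoothness through a direct limit chart and the main theorem -/

/-- A continuous homomorphism which is smooth on each of the Lie groups of an ascending union with
a direct limit chart is smooth. -/
theorem AdmitsDirectLimitChart.isCInftyMap {𝕜 : Type*} [RCLike 𝕜]
    {E : Type u} [AddCommGroup E] [Module 𝕜 E] [TopologicalSpace E]
    {G : Type*} [Group G] [TopologicalSpace G] [ChartedSpace E G]
    {En : ℕ → Type*} [∀ n, AddCommGroup (En n)] [∀ n, Module 𝕜 (En n)]
    [∀ n, TopologicalSpace (En n)]
    {Gn : ℕ → Type*} [∀ n, Group (Gn n)] [∀ n, TopologicalSpace (Gn n)]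
    [∀ n, ChartedSpace (En n) (Gn n)]
    {ι : ∀ {m n : ℕ}, m ≤ n → (Gn m →* Gn n)} {i : ∀ n, Gn n →* G}
    (hchart : AdmitsDirectLimitChart 𝕜 E En ι i) (hunion : IsAscendingUnion 𝕜 E En ι i)
    {F : Type v} [AddCommGroup F] [Module 𝕜 F] [TopologicalSpace F]
    {H : Type*} [Group H] [TopologicalSpace H] [ChartedSpace F H] (hH : IsCInftyLieGroup 𝕜 F H)
    (f : G →* H) (hf : Continuous f) (hfs : ∀ n, IsCInftyMap 𝕜 (En n) F (f.comp (i n))) :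
    IsCInftyMap 𝕜 E F f := by
  obtain ⟨φ, h1, hφ, n₀, jj, j, φs, hlcs, hj, hφs, hsource, htarget, hφsource, hφtarget, hφj⟩ :=
    hchart
  have hG := hunion.lieGroup
  have hGn := hunion.lieGroup_seq
  have hE := hG.manifold.model_locallyConvex
  have := hE.topologicalAddGroup
  have := hE.continuousSMul
  have := hG.manifold.model_t2
  have hF := hH.manifold.model_locallyConvex
  have := hF.topologicalAddGroup
  have := hF.continuousSMul
  have := hH.manifold.model_t2
  have := fun n => (hGn n).manifold.model_locallyConvex.topologicalAddGroup
  have := fun n => (hGn n).manifold.model_locallyConvex.continuousSMul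
  have := fun n => (hGn n).manifold.model_t2
  set ψ := chartAt F (1 : H)
  have hψ : IsCInftyChart 𝕜 ψ := hH.manifold.isCInftyChart (chart_mem_atlas F 1)
  have h1ψ : (1 : H) ∈ ψ.source := mem_chart_source F 1
  have hcompat : ∀ n ≥ n₀, ∀ g ∈ (φs n).source, i n g ∈ φ.source ∧ φ (i n g) = j n (φs n g) :=
    fun n hn g hg => ⟨by rw [hφsource]; exact mem_iUnion₂.2 ⟨n, hn, g, hg, rfl⟩, hφj n hn g hg⟩
  -- A level from which on the charts `φs n` are charts around `1`; injectivity of `i n₁` identifies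
  -- the preimage of `1`.
  obtain ⟨n₁, hn₁, hone⟩ : ∃ n₁ ≥ n₀, ∀ n ≥ n₁, (1 : Gn n) ∈ (φs n).source := by
    rw [hφsource] at h1
    obtain ⟨n₁, hn₁, g, hg, hg1⟩ := mem_iUnion₂.1 h1
    obtain rfl : g = 1 := hunion.injective n₁ (by rw [hg1, map_one])
    exact ⟨n₁, hn₁, fun n hn => hsource n₁ n hn hn₁ ⟨1, hg, map_one _⟩⟩
  have hvec : ∀ v : E, ∃ n₂ ≥ n₁, ∀ n ≥ n₂, ∃ a, j n a = v := by
    intro v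
    obtain ⟨m, hm, a, rfl⟩ : ∃ m, n₀ ≤ m ∧ v ∈ range (j m) := by
      simpa using (Set.ext_iff.1 hj v).2 (mem_univ v)
    exact ⟨max m n₁, le_max_right _ _, fun n hn =>
      ⟨jj m n a, hlcs.cone m n hm ((le_max_left _ _).trans hn) a⟩⟩
  have hpt : ∀ x ∈ φ.target, ∃ n₂, ∀ n ≥ n₂, ∃ q ∈ (φs n).source, j n (φs n q) = x := by
    intro x hx
    rw [hφtarget] at hx
    obtain ⟨m, hm, a, ha, rfl⟩ := mem_iUnion₂.1 hx
    refine ⟨m, fun n hn => ?_⟩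
    have hb := htarget m n hn hm ⟨a, ha, rfl⟩
    exact ⟨(φs n).symm (jj m n a), (φs n).map_target hb, by
      rw [(φs n).right_inv hb, hlcs.cone m n hm hn]⟩
  have hsm : ∀ n ≥ n₀, ∀ q ∈ (φs n).source, f (i n q) ∈ ψ.source →
      IsSmoothAt 𝕜 (φs n) ψ (f.comp (i n)) q := fun n hn q hq hfq =>
    (hfs n).isSmoothAt (hGn n).manifold hH.manifold (hφs n hn) hψ hq hfq
  have hdiff : ∀ n ≥ n₁, ∀ a, dirDeriv 𝕜 (ψ ∘ f ∘ φ.symm) (φ 1, j n a) =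
      dirDeriv 𝕜 (ψ ∘ f.comp (i n) ∘ (φs n).symm) (φs n 1, a) := by
    intro n hn a
    rw [← dirDeriv_of_compatible (hcompat n (hn₁.trans hn)) (f := f)
      (f' := f.comp (i n)) (fun g => rfl) ψ (hone n hn),
      ← (hcompat n (hn₁.trans hn) 1 (hone n hn)).2, map_one]
  have hdiff' : ∀ n ≥ n₁, ∃ L : En n →L[𝕜] F,
      ∀ a, dirDeriv 𝕜 (ψ ∘ f ∘ φ.symm) (φ 1, j n a) = L a := by
    intro n hn
    obtain ⟨L, hL⟩ := (hsm n (hn₁.trans hn) 1 (hone n hn)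
      (by simpa using h1ψ)).exists_differential hF
    exact ⟨L, fun a => by rw [hdiff n hn, hL]⟩
  -- The candidate differential at `1`. Additivity and homogeneity are checked at a level containing
  -- the vectors concerned, where smoothness on `Gn n` applies.
  let L₀ : E →ₗ[𝕜] F :=
    { toFun := fun v => dirDeriv 𝕜 (ψ ∘ f ∘ φ.symm) (φ 1, v)
      map_add' := fun v w => by
        obtain ⟨n₂, h₂, hv⟩ := hvec v
        obtain ⟨n₃, h₃, hw⟩ := hvec w
        obtain ⟨a, rfl⟩ := hv (max n₂ n₃) (le_max_left _ _)
        obtain ⟨b, rfl⟩ := hw (max n₂ n₃) (le_max_right _ _)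
        obtain ⟨L, hL⟩ := hdiff' (max n₂ n₃) (h₂.trans (le_max_left _ _))
        rw [← map_add, hL, hL, hL, map_add]
      map_smul' := fun c v => by
        obtain ⟨n₂, h₂, hv⟩ := hvec v
        obtain ⟨a, rfl⟩ := hv n₂ le_rfl
        obtain ⟨L, hL⟩ := hdiff' n₂ h₂
        rw [← map_smul, hL, hL, map_smul, RingHom.id_apply] }
  have hL₀ : Continuous L₀ := by
    refine hlcs.continuous_of_restrict hj hF L₀ fun n hn => ?_
    -- For `n < n₁` the chart `φs n` need not contain `1`, so vectors are first pushed to level `max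
    -- n n₁`.
    obtain ⟨L, hL⟩ := hdiff' (max n n₁) (le_max_right _ _)
    refine (L.continuous.comp (jj n (max n n₁)).continuous).congr fun y => ?_
    rw [← hlcs.cone n (max n n₁) hn (le_max_left _ _) y]
    exact (hL _).symm
  let L : E →L[𝕜] F := ⟨L₀, hL₀⟩
  have hU := isOpen_chart_domain hf φ ψ
  have hck := isCkOn_of_trivialized_differential hG hH hφ hψ h1 h1ψ (f := ψ ∘ f ∘ φ.symm) hU
    inter_subset_left
    (ψ.continuousOn.comp (hf.comp_continuousOn (φ.continuousOn_symm.mono inter_subset_left))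
      fun x hx => hx.2) (fun x hx => ψ.map_source hx.2) L ?_
  · exact isCInftyMap_of_isSmoothAt_one hG hH hφ hψ h1 h1ψ hf
      ⟨_, hU, ⟨φ.map_source h1, by simpa [h1] using h1ψ⟩, hck⟩
  · rintro x ⟨hx, hfx⟩ y
    obtain ⟨n₂, h₂, hy⟩ := hvec y
    obtain ⟨n₃, hx⟩ := hpt x hx
    -- One level at which both the point `x` and the direction `y` are represented.
    obtain ⟨n, hn₂, hn₃⟩ : ∃ n, n₂ ≤ n ∧ n₃ ≤ n := ⟨_, le_max_left _ _, le_max_right _ _⟩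
    have hn₁' : n₁ ≤ n := h₂.trans hn₂
    have hn₀ : n₀ ≤ n := hn₁.trans hn₁'
    obtain ⟨a, rfl⟩ := hy n hn₂
    obtain ⟨q, hq, rfl⟩ := hx n hn₃
    have hc := hcompat n hn₀
    have hφq : φ.symm (j n (φs n q)) = i n q := by
      rw [symm_apply_of_compatible hc ((φs n).map_source hq), (φs n).left_inv hq]
    have hfq : f (i n q) ∈ ψ.source := by
      have : f (φ.symm (j n (φs n q))) ∈ ψ.source := hfx
      rwa [hφq] at this
    have hd := hasDirectionalDeriv_comp_continuousLinearMap.1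
      (((hsm n hn₀ q hq hfq).hasDirectionalDeriv a).congr
        (eventuallyEq_of_compatible hc (f := f) (f' := f.comp (i n))
          (fun g => rfl) ψ hq).symm)
    -- Trivialise at level `n`, then replace the differential at `1` and the left translation of `Gn
    -- n` by those of `G`; the formula no longer depends on `n`.
    rw [dirDeriv_monoidHom (hGn n) hH (hφs n hn₀) hψ (hone n hn₁') h1ψ (hfs n).1
      (hsm n hn₀ 1 (hone n hn₁') (by simpa using h1ψ)) hq hfq, ← hdiff n hn₁',
      ← dirDeriv_mul_left_of_compatible (hGn n) (hφs n hn₀) (hone n hn₁') hc hq] at hd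
    convert hd using 1
    -- In the direction `(0, y)` the first factor of `q.1⁻¹ * q.2` stays fixed, so its difference
    -- quotients are those of left translation by `(i n q)⁻¹`.
    simp [L, L₀, dirDeriv, hφq]

theorem theorem2p6 {𝕜 : Type*} [RCLike 𝕜]
    {E : Type*} [AddCommGroup E] [Module 𝕜 E] [TopologicalSpace E]
    {G : Type*} [Group G] [TopologicalSpace G] [ChartedSpace E G]
    {En : ℕ → Type*} [∀ n, AddCommGroup (En n)] [∀ n, Module 𝕜 (En n)]
    [∀ n, TopologicalSpace (En n)]
    {Gn : ℕ → Type*} [∀ n, Group (Gn n)] [∀ n, TopologicalSpace (Gn n)]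
    [∀ n, ChartedSpace (En n) (Gn n)]
    (ι : ∀ {m n : ℕ}, m ≤ n → (Gn m →* Gn n)) (i : ∀ n, Gn n →* G)
    (hunion : IsAscendingUnion 𝕜 E En ι i)
    (hchart : AdmitsDirectLimitChart 𝕜 E En ι i)
    (hlim : IsDirectLimitTopGroup ι i) :
    IsDirectLimitLieGroup.{v, w} 𝕜 E En ι i := by
  refine ⟨hunion.cInfty_incl, hunion.comp, ?_⟩
  intro F _ _ _ H _ _ _ hH f hf hfι
  have := hH.isTopologicalGroup
  obtain ⟨f', hf'⟩ := exists_monoidHom_of_ascending_union hunion.injective hunion.comp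
    hunion.iUnion_range f hfι
  have hcomp : ∀ n, f'.comp (i n) = f n := fun n => MonoidHom.ext (hf' n)
  have hcont : Continuous f' := hlim.continuous_of_restrict hunion.iUnion_range f' fun n => by
    simpa only [hf'] using (hf n).1
  refine ⟨f', ⟨hchart.isCInftyMap hunion hH f' hcont fun n => by rw [hcomp]; exact hf n, hf'⟩, ?_⟩
  rintro f'' ⟨-, hf''⟩
  refine MonoidHom.ext fun x => ?_
  obtain ⟨n, g, rfl⟩ : ∃ n, ∃ g : Gn n, i n g = x := by
    simpa using (Set.ext_iff.1 hunion.iUnion_range x).2 (mem_univ x)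
  rw [hf', hf'']
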